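/- Let $n\ge 1$. For $\alpha_0,\dots,\alpha_{n-2}\in\mathbb D$ and $\alpha_{n-1}\in S^1$ put $\alpha_{-1}=-1$, $\rho_k=\sqrt{1-|\alpha_k|^2}$, $\Xi_k=\begin{bmatrix}\bar\alpha_k&\rho_k\\ \rho_k&-\alpha_k\end{bmatrix}$ for $0\le k\le n-2$, $\Xi_{-1}=[1]$, $\Xi_{n-1}=[\bar\alpha_{n-1}]$, and let $\mathcal C=\mathcal L\mathcal M$ with $\mathcal L=\operatorname{diag}(\Xi_0,\Xi_2,\dots)$, $\mathcal M=\operatorname{diag}(\Xi_{-1},\Xi_1,\Xi_3,\dots)$ be the associated $n\times n$ CMV matrix. On complex $n\times n$ matrices let $\langle X,Y\rangle=\operatorname{Im}\operatorname{tr}(XY)$, let $\nabla\phi$ be the gradient of a real-valued function $\phi$ with respect to this pairing, let $R=\pi_{\mathfrak l}-\pi_{\mathfrak a}$, where $\pi_{\mathfrak l},\pi_{\mathfrak a}$ are the projections for the splitting into lower triangular matrices with real diagonal and anti-Hermitian matrices, and let $$\{\phi,\psi\}|_B=\tfrac12\langle R(\nabla\phi\, B),\nabla\psi\, B\rangle-\tfrac12\langle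 R(B\nabla\phi),B\nabla\psi\rangle$$ be the Gelfand--Dikij bracket. Let $f$ be a complex polynomial, $\phi(B)=\operatorname{Im}\operatorname{tr} f(B)$ and $F(z)=2\operatorname{Re}[zf'(z)]$. Let $t\mapsto(\alpha_0(t),\dots,\alpha_{n-1}(t))\in\mathbb D^{n-1}\times S^1$, $t\in\mathbb R$, be a solution of the Hamiltonian flow generated by $\phi$: the corresponding CMV matrices $\mathcal C(t)$ satisfy $\frac{d}{dt}\psi(\mathcal C(t))=\{\phi,\psi\}(\mathcal C(t))$ for every differentiable real-valued $\psi$. Let $z_1,\dots,z_n$ be the eigenvalues of $\mathcal C(0)$, let $\mu_j$ be the mass given to $z_j$ by the spectral measure of $\mathcal C(0)$ and the vector $e_1$, put $\lambda_j=F(z_j)$, and suppose that all $\lambda_j$ are distinct, labelled so that $\lambda_1>\lambda_2>\cdots>\lambda_n$. For $1\le k\le n-1$ put $$\xi_{k-1}=(z_k\bar z_{k+1}-1)\frac{\mu_{k+1}}{\mu_k}\prod_{l=1}^{k-1}\left|\frac{z_{k+1}-z_l}{z_k-z_l}\right|^2,\qquad \zeta_{k-1}=(z_{n-k+1}\bar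 z_{n-k}-1)\frac{\mu_{n-k}}{\mu_{n-k+1}}\prod_{l=n-k+2}^{n}\left|\frac{z_{n-k}-z_l}{z_{n-k+1}-z_l}\right|^2 .$$ Then: 1. The eigenvalues of $\mathcal C(t)$ are $z_1,\dots,z_n$ for every $t$. 2. The numbers $\xi_{k-1},\zeta_{k-1}$ are the asymptotic constants of the solution: for each $1\le k\le n-1$ there is $\gamma>\lambda_k-\lambda_{k+1}>0$ with $$\alpha_{k-1}(t)=(-1)^{k-1}\bar z_1\cdots\bar z_k\left[1+\xi_{k-1}e^{-(\lambda_k-\lambda_{k+1})t}+O(e^{-\gamma t})\right]\quad(t\to+\infty),$$ and there is $\gamma>\lambda_{n-k}-\lambda_{n-k+1}>0$ with $$\alpha_{k-1}(t)=(-1)^{k-1}\bar z_n\cdots\bar z_{n-k+1}\left[1+\zeta_{k-1}e^{(\lambda_{n-k}-\lambda_{n-k+1})t}+O(e^{\gamma t})\right]\quad(t\to-\infty).$$ 3. For $1\le k\le n-1$, $$\xi_{k-1}\zeta_{n-k-1}=|z_{k+1}-z_k|^2\prod_{l=1}^{k-1}\left|\frac{z_{k+1}-z_l}{z_k-z_l}\right|^2\prod_{m=k+2}^{n}\left|\frac{z_k-z_m}{z_{k+1}-z_m}\right|^2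 .$$ 4. The limits $\alpha_j(\pm\infty)=\lim_{t\to\pm\infty}\alpha_j(t)$ exist for $-1\le j\le n-1$, and for $1\le k\le n-1$ and every $t\in\mathbb R$ $$\alpha_{k-1}(+\infty)\,\alpha_{n-k-1}(-\infty)=(-1)^n\bar z_1\cdots\bar z_n=(-1)^n\det(\mathcal C(t)^\dagger)=-\alpha_{n-1}(t),$$ which is independent of $t$. 5. For $1\le j\le n$ (the denominators being non-zero) $$z_j=-\frac{\alpha_{j-2}(+\infty)}{\alpha_{j-1}(+\infty)}=-\frac{\alpha_{n-j-1}(-\infty)}{\alpha_{n-j}(-\infty)} .$$ -/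

import Mathlib

open scoped ComplexConjugate Matrix Topology

namespace CMV

/-- Admissible Verblunsky coefficients `α 0, …, α (n-1)`: the first `n - 1` lie in the open unit
disk and the last one on the unit circle (values `α j` with `j ≥ n` play no role). -/
def IsVerblunsky (n : ℕ) (α : ℕ → ℂ) : Prop :=
  (∀ j, j + 1 < n → ‖α j‖ < 1) ∧ ‖α (n - 1)‖ = 1

/-- The Verblunsky coefficients with the index shifted by one, so as to include the customary
convention `α_{-1} = -1`: `shifted α m` is `α_{m-1}`. -/
def shifted (α : ℕ → ℂ) : ℕ → ℂ
  | 0 => -1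
  | m + 1 => α m

/-- `ρ_k = √(1 - |α_k|²)`. -/
noncomputable def rho (α : ℕ → ℂ) (k : ℕ) : ℝ := Real.sqrt (1 - ‖α k‖ ^ 2)

/-- The `n × n` block-diagonal matrix whose blocks are `Ξ_k = [[conj α_k, ρ_k], [ρ_k, -α_k]]` in
rows and columns `k, k + 1` (counted from `0`), for all `k ≤ n - 2` with `k ≡ p` mod 2, together
with the `1 × 1` blocks `Ξ_{n-1} = [conj α_{n-1}]` in position `n - 1` (if `n - 1 ≡ p`) and
`Ξ_{-1} = [1] = [-α_{-1}]` in position `0` (if `p` is odd). -/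
noncomputable def blockDiag (n : ℕ) (α : ℕ → ℂ) (p : ℕ) : Matrix (Fin n) (Fin n) ℂ :=
  Matrix.of fun i j =>
    if i = j then
      if (i : ℕ) % 2 = p % 2 then conj (α i) else -shifted α i
    else if (j : ℕ) = i + 1 ∧ (i : ℕ) % 2 = p % 2 then (rho α i : ℂ)
    else if (i : ℕ) = j + 1 ∧ (j : ℕ) % 2 = p % 2 then (rho α j : ℂ)
    else 0

/-- The CMV matrix `𝓛 𝓜`, `𝓛 = diag(Ξ_0, Ξ_2, …)`, `𝓜 = diag(Ξ_{-1}, Ξ_1, Ξ_3, …)`. -/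
noncomputable def cmv (n : ℕ) (α : ℕ → ℂ) : Matrix (Fin n) (Fin n) ℂ :=
  blockDiag n α 0 * blockDiag n α 1

/-- Projection of complex matrices onto the anti-Hermitian ones along the lower triangular
matrices with real diagonal. -/
noncomputable def projA {n : ℕ} (X : Matrix (Fin n) (Fin n) ℂ) : Matrix (Fin n) (Fin n) ℂ :=
  Matrix.of fun i j =>
    if i < j then X i j
    else if i = j then Complex.I * ((X i i).im : ℂ)
    else -conj (X j i)

/-- The complementary projection onto the lower triangular matrices with real diagonal. -/
noncomputable def projL {n : ℕ} (X : Matrix (Fin n) (Fin n) ℂ) : Matrix (Fin n) (Fin n) ℂ :=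
  X - projA X

/-- The `R`-matrix `R = π_l - π_a`. -/
noncomputable def R {n : ℕ} (X : Matrix (Fin n) (Fin n) ℂ) : Matrix (Fin n) (Fin n) ℂ :=
  projL X - projA X

/-- The pairing `⟨X, Y⟩ = Im tr (X Y)`. -/
noncomputable def pairing {n : ℕ} (X Y : Matrix (Fin n) (Fin n) ℂ) : ℝ :=
  (X * Y).trace.im

/-- The gradient of `φ` with respect to `pairing`: its `(k, l)` entry is
`∂φ/∂v_{l,k} + i ∂φ/∂u_{l,k}`, where `u + i v` are the matrix entries. -/
noncomputable def grad {n : ℕ} (φ : Matrix (Fin n) (Fin n) ℂ → ℝ)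
    (B : Matrix (Fin n) (Fin n) ℂ) : Matrix (Fin n) (Fin n) ℂ :=
  Matrix.of fun k l =>
    ((lineDeriv ℝ φ B (Matrix.single l k Complex.I) : ℝ) : ℂ)
      + Complex.I * ((lineDeriv ℝ φ B (Matrix.single l k 1) : ℝ) : ℂ)

/-- The Gelfand–Dikij (quadratic, Sklyanin) Poisson bracket on the space of matrices. -/
noncomputable def bracket {n : ℕ} (φ ψ : Matrix (Fin n) (Fin n) ℂ → ℝ)
    (B : Matrix (Fin n) (Fin n) ℂ) : ℝ :=
  1 / 2 * pairing (R (grad φ B * B)) (grad ψ B * B)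
    - 1 / 2 * pairing (R (B * grad φ B)) (B * grad ψ B)

/-- `B` is an integral curve, defined for all times, of the Hamiltonian flow generated by `φ`:
`d/dt ψ(B(t)) = {φ, ψ}(B(t))` for every differentiable function `ψ` on the space of matrices. -/
def IsFlow {n : ℕ} (φ : Matrix (Fin n) (Fin n) ℂ → ℝ)
    (B : ℝ → Matrix (Fin n) (Fin n) ℂ) : Prop :=
  ∀ ψ : Matrix (Fin n) (Fin n) ℂ → ℝ, Differentiable ℝ ψ →
    ∀ t : ℝ, HasDerivAt (fun s => ψ (B s)) (bracket φ ψ (B t)) t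

/-- The Ablowitz–Ladik Hamiltonian `φ(B) = Im tr f(B)`. -/
noncomputable def hamiltonian (n : ℕ) (f : Polynomial ℂ) (B : Matrix (Fin n) (Fin n) ℂ) : ℝ :=
  (Polynomial.aeval B f).trace.im

/-- `F(z) = 2 Re (z f'(z))`. -/
noncomputable def speed (f : Polynomial ℂ) (z : ℂ) : ℝ :=
  2 * (z * f.derivative.eval z).re

/-- The first standard basis vector `e₁`. -/
noncomputable def e1 (n : ℕ) : EuclideanSpace ℂ (Fin n) :=
  WithLp.toLp 2 fun i => if (i : ℕ) = 0 then 1 else 0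

/-- The mass which the spectral measure of the unitary matrix `C` and the vector `e₁` gives to the
point `w`: the squared length of the orthogonal projection of `e₁` to `ker (C - w)`. -/
noncomputable def spectralMass {n : ℕ} (C : Matrix (Fin n) (Fin n) ℂ) (w : ℂ) : ℝ :=
  ‖(Module.End.eigenspace (Matrix.toEuclideanLin C) w).starProjection (e1 n)‖ ^ 2

/-- The constant `ξ_{k-1}`, `1 ≤ k ≤ n - 1`. -/
noncomputable def xi (z : ℕ → ℂ) (μ : ℕ → ℝ) (k : ℕ) : ℂ :=
  (z k * conj (z (k + 1)) - 1) * ((μ (k + 1) / μ k : ℝ) : ℂ)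
    * ((∏ l ∈ Finset.Icc 1 (k - 1), ‖(z (k + 1) - z l) / (z k - z l)‖ ^ 2 : ℝ) : ℂ)

/-- The constant `ζ_{k-1}`, `1 ≤ k ≤ n - 1`. -/
noncomputable def zeta (n : ℕ) (z : ℕ → ℂ) (μ : ℕ → ℝ) (k : ℕ) : ℂ :=
  (z (n - k + 1) * conj (z (n - k)) - 1) * ((μ (n - k) / μ (n - k + 1) : ℝ) : ℂ)
    * ((∏ l ∈ Finset.Icc (n - k + 2) n,
          ‖(z (n - k) - z l) / (z (n - k + 1) - z l)‖ ^ 2 : ℝ) : ℂ)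

end CMV

/-! The gradient of `Im tr f` at B is f'(B), which commutes with B, so the bracket collapses to a
Lax equation B' = [A, B] with A = π_a(B f'(B)) anti-Hermitian (`bracket_hamiltonian`,
`IsFlow.entryDeriv`). Every quantity tr(p(B)ᴴ p(B)) is therefore conserved, so B(t) and B(0) are
annihilated by the same polynomials and have the same spectrum. The first row of A is known
explicitly, and it yields μ_j' = (F(z_j) - c(t)) μ_j with c independent of j (`hasDerivAt_mass`): up
to a common factor, μ_j(t) is μ_j e^{λ_j t}.

Heine's formula leads back to the coefficients. The leading minor of order k + 1 of the CMV matrix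
is (-1)^k conj α_k (`det_cmv`, `cmv_submatrix`), and Cauchy–Binet expands it in an orthonormal
eigenbasis. Eigenvector components are Laurent polynomials in the eigenvalue, so the minors that
occur are, in modulus, Vandermonde determinants times first components and a constant
(`exists_minor_eq`). Thus (-1)^k α_k is the mean of ∏_{j ∈ S} conj z_j over the (k + 1)-subsets S,
with weights ∏ μ_j ∏ |z_a - z_b|² (`heine`). Along the flow the weight of S gains the factor exp(t
∑_S λ_j), and the common factor cancels (`verblunsky_eq_heineMean`).

For k-subsets the largest exponent belongs to {1, …, k} and the second largest, uniquely, to {1, …,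
k-1, k+1} (`sum_lt_of_card_eq`). The first subset gives the limit of α_{k-1}, the second the
correction ξ_{k-1}. Time reversal with the reversed labelling of the eigenvalues gives t → -∞. The
product and quotient formulas are then algebra on the unit circle. -/

namespace CMV

/-! ### Leading asymptotics of exponentially tilted means -/

/-- The expectation of `b` for the exponentially tilted weights `w s * exp (Λ s * t)`. -/
noncomputable def tiltedMean {ι : Type*} (I : Finset ι) (w Λ : ι → ℝ) (b : ι → ℂ) (t : ℝ) : ℂ :=
  (∑ s ∈ I, b s * ((w s * Real.exp (Λ s * t) : ℝ) : ℂ)) /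
    ((∑ s ∈ I, w s * Real.exp (Λ s * t) : ℝ) : ℂ)

lemma isBigO_exp_neg {c γ : ℝ} (h : γ ≤ c) (a : ℝ) :
    (fun t : ℝ => a * Real.exp (-c * t)) =O[Filter.atTop] fun t : ℝ => Real.exp (-γ * t) := by
  refine Asymptotics.IsBigO.of_bound |a| ?_
  filter_upwards [Filter.eventually_ge_atTop 0] with t ht
  rw [norm_mul, Real.norm_eq_abs, Real.norm_eq_abs, Real.norm_eq_abs, Real.abs_exp, Real.abs_exp]
  gcongr

/-- After division by the dominant term, numerator and denominator are sums of decaying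
exponentials. Only `s₁` contributes at the rate of the gap; everything else decays strictly faster.
-/
theorem tiltedMean_asymptotics {ι : Type*} [DecidableEq ι] (I : Finset ι) {s₀ s₁ : ι}
    (h₀ : s₀ ∈ I) (h₁ : s₁ ∈ I) (w Λ : ι → ℝ) (b : ι → ℂ) (hw : ∀ s ∈ I, 0 < w s)
    (h10 : Λ s₁ < Λ s₀) (hΛ : ∀ s ∈ I, s ≠ s₀ → s ≠ s₁ → Λ s < Λ s₁) :
    ∃ γ : ℝ, Λ s₀ - Λ s₁ < γ ∧
      (fun t : ℝ => tiltedMean I w Λ b t - (b s₀ + (b s₁ - b s₀) *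
        ((w s₁ / w s₀ * Real.exp (-(Λ s₀ - Λ s₁) * t) : ℝ) : ℂ)))
        =O[Filter.atTop] fun t : ℝ => Real.exp (-γ * t) := by
  set δ := Λ s₀ - Λ s₁ with hδ
  have hδ0 : 0 < δ := by simp [hδ, h10]
  -- The bound 2δ accounts for the products of `E s₁` with terms of gap at least δ that clearing the
  -- denominator creates; the other bounds come from the remaining indices.
  obtain ⟨γ, hγ, hγ2, hγI⟩ : ∃ γ : ℝ, δ < γ ∧ γ < 2 * δ ∧
      ∀ s ∈ I, s ≠ s₀ → s ≠ s₁ → γ < Λ s₀ - Λ s := by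
    have e1 : ∀ᶠ γ in 𝓝[>] δ, δ < γ := self_mem_nhdsWithin
    have e2 : ∀ᶠ γ in 𝓝[>] δ, γ < 2 * δ :=
      nhdsWithin_le_nhds (Iio_mem_nhds (by linarith))
    have e3 : ∀ᶠ γ in 𝓝[>] δ, ∀ s ∈ I, s ≠ s₀ → s ≠ s₁ → γ < Λ s₀ - Λ s := by
      refine (Filter.eventually_all_finset I).2 fun s hs => ?_
      by_cases h : s ≠ s₀ ∧ s ≠ s₁
      · have : δ < Λ s₀ - Λ s := by have := hΛ s hs h.1 h.2; simp only [hδ]; linarith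
        filter_upwards [nhdsWithin_le_nhds (Iio_mem_nhds this)] with γ hγ _ _ using hγ
      · exact Filter.Eventually.of_forall fun γ h1 h2 => absurd ⟨h1, h2⟩ h
    exact (e1.and (e2.and e3)).exists
  refine ⟨γ, hγ, ?_⟩
  set E : ι → ℝ → ℝ := fun s t => w s / w s₀ * Real.exp (-(Λ s₀ - Λ s) * t) with hE
  set J := I.erase s₀ with hJ
  set K := J.erase s₁ with hK
  have hne : s₁ ≠ s₀ := fun h => by rw [h] at h10; exact lt_irrefl _ h10
  have h1J : s₁ ∈ J := Finset.mem_erase.2 ⟨hne, h₁⟩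
  have hw0 := hw s₀ h₀
  have hE0 : ∀ t, E s₀ t = 1 := fun t => by simp [hE, hw0.ne']
  have hEpos : ∀ s ∈ I, ∀ t, 0 < E s t := fun s hs t => by
    have := hw s hs
    simp only [hE]; positivity
  have hwE : ∀ s t, w s * Real.exp (Λ s * t) = (w s₀ * Real.exp (Λ s₀ * t)) * E s t := by
    intro s t
    have : Real.exp (Λ s * t) = Real.exp (Λ s₀ * t) * Real.exp (-(Λ s₀ - Λ s) * t) := by
      rw [← Real.exp_add]; congr 1; ring
    simp only [hE]
    rw [this]; field_simp
  have hD : ∀ t, 1 ≤ ∑ s ∈ I, E s t := fun t => by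
    rw [← Finset.add_sum_erase I _ h₀, hE0]
    have := Finset.sum_nonneg fun s (hs : s ∈ J) => (hEpos s (Finset.mem_of_mem_erase hs) t).le
    linarith
  -- An exact formula for the remainder: its denominator is at least 1, so only the numerator needs
  -- to be estimated.
  have key : ∀ t, tiltedMean I w Λ b t - (b s₀ + (b s₁ - b s₀) * ((E s₁ t : ℝ) : ℂ)) =
      (∑ s ∈ K, (b s - b s₀) * (E s t : ℂ) -
        (b s₁ - b s₀) * ∑ s ∈ J, ((E s₁ t * E s t : ℝ) : ℂ)) *
        (((∑ s ∈ I, E s t)⁻¹ : ℝ) : ℂ) := by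
    intro t
    have hc : ((w s₀ * Real.exp (Λ s₀ * t) : ℝ) : ℂ) ≠ 0 := by
      exact_mod_cast (mul_pos hw0 (Real.exp_pos _)).ne'
    have hDne : (((∑ s ∈ I, E s t : ℝ)) : ℂ) ≠ 0 := by
      exact_mod_cast (zero_lt_one.trans_le (hD t)).ne'
    have hmean : tiltedMean I w Λ b t =
        (∑ s ∈ I, b s * (E s t : ℂ)) / ((∑ s ∈ I, E s t : ℝ) : ℂ) := by
      have a1 : ∑ s ∈ I, b s * ((w s * Real.exp (Λ s * t) : ℝ) : ℂ) =
          ((w s₀ * Real.exp (Λ s₀ * t) : ℝ) : ℂ) * ∑ s ∈ I, b s * (E s t : ℂ) := by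
        rw [Finset.mul_sum]
        refine Finset.sum_congr rfl fun s _ => ?_
        rw [hwE s t, Complex.ofReal_mul]; ring
      have a2 : ∑ s ∈ I, w s * Real.exp (Λ s * t) =
          (w s₀ * Real.exp (Λ s₀ * t)) * ∑ s ∈ I, E s t := by
        rw [Finset.mul_sum]
        exact Finset.sum_congr rfl fun s _ => hwE s t
      rw [tiltedMean, a1, a2, Complex.ofReal_mul (w s₀ * _), mul_div_mul_left _ _ hc]
    rw [hmean, Complex.ofReal_inv, ← div_eq_mul_inv, eq_div_iff hDne, sub_mul,
      div_mul_cancel₀ _ hDne]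
    have b1 : ∑ s ∈ I, b s * (E s t : ℂ) =
        b s₀ + (b s₁ * (E s₁ t : ℂ) + ∑ s ∈ K, b s * (E s t : ℂ)) := by
      rw [← Finset.add_sum_erase I _ h₀, ← Finset.add_sum_erase J _ h1J, hE0]; simp [hK]
    have b2 : ((∑ s ∈ I, E s t : ℝ) : ℂ) = 1 + ∑ s ∈ J, (E s t : ℂ) := by
      rw [← Finset.add_sum_erase I _ h₀, hE0]; push_cast; rfl
    have b3 : ∑ s ∈ J, (E s t : ℂ) = E s₁ t + ∑ s ∈ K, (E s t : ℂ) :=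
      (Finset.add_sum_erase J _ h1J).symm
    have b4 : ∑ s ∈ J, ((E s₁ t * E s t : ℝ) : ℂ) = E s₁ t * ∑ s ∈ J, (E s t : ℂ) := by
      rw [Finset.mul_sum]; push_cast; rfl
    have b5 : ∑ s ∈ K, (b s - b s₀) * (E s t : ℂ) =
        ∑ s ∈ K, b s * (E s t : ℂ) - b s₀ * ∑ s ∈ K, (E s t : ℂ) := by
      rw [Finset.mul_sum, ← Finset.sum_sub_distrib]
      exact Finset.sum_congr rfl fun s _ => by ring
    rw [b1, b2, b4, b5, b3]; ring
  have hfun : (fun t : ℝ => tiltedMean I w Λ b t - (b s₀ + (b s₁ - b s₀) *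
      ((w s₁ / w s₀ * Real.exp (-δ * t) : ℝ) : ℂ))) = fun t =>
      (∑ s ∈ K, (b s - b s₀) * (E s t : ℂ) -
        (b s₁ - b s₀) * ∑ s ∈ J, ((E s₁ t * E s t : ℝ) : ℂ)) *
        (((∑ s ∈ I, E s t)⁻¹ : ℝ) : ℂ) := funext key
  rw [hfun]
  have hinv : (fun t => (((∑ s ∈ I, E s t)⁻¹ : ℝ) : ℂ)) =O[Filter.atTop]
      fun _ => (1 : ℝ) := by
    refine Asymptotics.IsBigO.of_bound 1 (Filter.Eventually.of_forall fun t => ?_)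
    have := hD t
    rw [Complex.norm_real, norm_inv, norm_one, mul_one, Real.norm_eq_abs,
      abs_of_pos (by linarith)]
    exact inv_le_one_of_one_le₀ this
  have hcast : ∀ {g : ℝ → ℝ} {h : ℝ → ℝ}, g =O[Filter.atTop] h →
      (fun t => ((g t : ℝ) : ℂ)) =O[Filter.atTop] h := fun {g h} hg =>
    Asymptotics.IsBigO.trans (Asymptotics.IsBigO.of_bound 1
      (Filter.Eventually.of_forall fun t => by simp)) hg
  have hnum : (fun t => ∑ s ∈ K, (b s - b s₀) * (E s t : ℂ) -
      (b s₁ - b s₀) * ∑ s ∈ J, ((E s₁ t * E s t : ℝ) : ℂ)) =O[Filter.atTop]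
      fun t : ℝ => Real.exp (-γ * t) := by
    refine Asymptotics.IsBigO.sub ?_ ?_
    · refine Asymptotics.IsBigO.fun_sum fun s hs => ?_
      obtain ⟨hs1, hs⟩ := Finset.mem_erase.1 hs
      obtain ⟨hs0, hs⟩ := Finset.mem_erase.1 hs
      exact (hcast (isBigO_exp_neg (hγI s hs hs0 hs1).le _)).const_mul_left _
    · refine Asymptotics.IsBigO.const_mul_left ?_ _
      refine Asymptotics.IsBigO.fun_sum fun s hs => ?_
      obtain ⟨hs0, hs⟩ := Finset.mem_erase.1 hs
      have hgap : δ ≤ Λ s₀ - Λ s := by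
        by_cases h : s = s₁
        · rw [h]
        · have := hΛ s hs hs0 h; simp only [hδ]; linarith
      have : (fun t => E s₁ t * E s t) = fun t => (w s₁ / w s₀ * (w s / w s₀)) *
          Real.exp (-(δ + (Λ s₀ - Λ s)) * t) := by
        funext t
        have : Real.exp (-(δ + (Λ s₀ - Λ s)) * t) =
            Real.exp (-δ * t) * Real.exp (-(Λ s₀ - Λ s) * t) := by
          rw [← Real.exp_add]; congr 1; ring
        simp only [hE]
        rw [this]; ring
      refine hcast ?_
      rw [this]
      exact isBigO_exp_neg (by linarith) _
  simpa using hnum.mul hinv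

/-! ### Subsets of eigenvalues, Heine weights and their asymptotics -/

/-- An exchange argument against Q = {1, …, k}. Each element of Q traded for one outside costs at
least λ_k - λ_{k+1}, so two trades cost more than that, and a single trade costs more unless it
replaces k by k + 1. -/
lemma sum_lt_of_card_eq {n k : ℕ} {lam : ℕ → ℝ} (hlam : StrictAntiOn lam (Set.Icc 1 n))
    (hk : 1 ≤ k) (hkn : k + 1 ≤ n) {S : Finset ℕ} (hS : S ⊆ Finset.Icc 1 n) (hc : S.card = k)
    (h₀ : S ≠ insert k (Finset.Icc 1 (k - 1))) (h₁ : S ≠ insert (k + 1) (Finset.Icc 1 (k - 1))) :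
    ∑ j ∈ S, lam j < ∑ j ∈ insert (k + 1) (Finset.Icc 1 (k - 1)), lam j := by
  set P := Finset.Icc 1 (k - 1) with hP
  have hkP : insert k P = Finset.Icc 1 k := by
    ext x; simp only [hP, Finset.mem_insert, Finset.mem_Icc]; omega
  have hk1P : k + 1 ∉ P := by simp only [hP, Finset.mem_Icc]; omega
  have hk0P : k ∉ P := by simp only [hP, Finset.mem_Icc]; omega
  have hd : lam (k + 1) < lam k := hlam ⟨hk, by omega⟩ ⟨by omega, hkn⟩ (by omega)
  set Q := insert k P with hQ
  have hQc : Q.card = k := by rw [hkP]; simp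
  have hsum : ∑ j ∈ insert (k + 1) P, lam j = ∑ j ∈ Q, lam j - (lam k - lam (k + 1)) := by
    rw [Finset.sum_insert hk1P, Finset.sum_insert hk0P]; ring
  have hcard : (Q \ S).card = (S \ Q).card := Finset.card_sdiff_comm (by rw [hQc, hc])
  have hsd : ∑ j ∈ Q, lam j - ∑ j ∈ S, lam j = ∑ j ∈ Q \ S, lam j - ∑ j ∈ S \ Q, lam j := by
    rw [← Finset.sum_inter_add_sum_sdiff Q S, ← Finset.sum_inter_add_sum_sdiff S Q,
      Finset.inter_comm S Q]; ring
  have hA : ∀ j ∈ Q \ S, lam k ≤ lam j := by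
    intro j hj
    have hj := (Finset.mem_sdiff.1 hj).1
    rw [hkP, Finset.mem_Icc] at hj
    exact hlam.antitoneOn ⟨hj.1, by omega⟩ ⟨hk, by omega⟩ hj.2
  have hBm : ∀ j ∈ S \ Q, k + 1 ≤ j ∧ j ≤ n := by
    intro j hj
    obtain ⟨h1, h2⟩ := Finset.mem_sdiff.1 hj
    have h1 := Finset.mem_Icc.1 (hS h1)
    rw [hkP, Finset.mem_Icc] at h2
    omega
  have hB : ∀ j ∈ S \ Q, lam j ≤ lam (k + 1) := by
    intro j hj
    have := hBm j hj
    exact hlam.antitoneOn ⟨by omega, hkn⟩ ⟨by omega, this.2⟩ this.1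
  have hAs := Finset.card_nsmul_le_sum _ _ _ hA
  have hBs := Finset.sum_le_card_nsmul _ _ _ hB
  rw [nsmul_eq_mul] at hAs hBs
  rw [hcard] at hAs
  have hpos : 0 < (S \ Q).card := by
    rw [Finset.card_pos, Finset.sdiff_nonempty]
    intro hsub
    exact h₀ (Finset.eq_of_subset_of_card_le hsub (by rw [hQc, hc]))
  rcases Nat.lt_or_ge 1 (S \ Q).card with h2 | h2
  · have h2' : (2 : ℝ) ≤ (S \ Q).card := by exact_mod_cast h2
    nlinarith
  · have h1 : (S \ Q).card = 1 := by omega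
    obtain ⟨b, hb⟩ := Finset.card_eq_one.1 h1
    obtain ⟨a, ha⟩ := Finset.card_eq_one.1 (hcard.trans h1)
    rw [ha, hb, Finset.sum_singleton, Finset.sum_singleton] at hsd
    have hbm := hBm b (by simp [hb])
    have ham : a ∈ Q ∧ a ∉ S := Finset.mem_sdiff.1 (by simp [ha])
    have ham' := ham.1
    rw [hkP, Finset.mem_Icc] at ham'
    have hSab : S = insert b (Q.erase a) := by
      have e1 : Q ∩ S = Q.erase a := by
        rw [← Finset.sdiff_singleton_eq_erase, ← ha, Finset.sdiff_sdiff_self_left]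
      rw [← Finset.sdiff_union_inter S Q, hb, Finset.inter_comm, e1]
      rfl
    have hne : a ≠ k ∨ b ≠ k + 1 := by
      by_contra! hab
      apply h₁
      rw [hSab, hab.1, hab.2, hQ, Finset.erase_insert hk0P]
    rcases hne with h | h
    · have := hlam (a := a) (b := k) ⟨ham'.1, by omega⟩ ⟨hk, by omega⟩ (by omega)
      have := hB b (by simp [hb])
      linarith
    · have := hlam (a := k + 1) (b := b) ⟨by omega, hkn⟩ ⟨by omega, hbm.2⟩ (by omega)
      have := hA a (by simp [ha])
      linarith

/-- `∏_{a ∈ S} μ_a · ∏_{{a, b} ⊆ S} |z_a - z_b|²`. -/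
noncomputable def heineWeight (z : ℕ → ℂ) (μ : ℕ → ℝ) (S : Finset ℕ) : ℝ :=
  ∏ a ∈ S, (μ a * ∏ b ∈ S.erase a, ‖z b - z a‖)

/-- The definition runs over ordered pairs, so each new pair enters twice and produces the square.
-/
lemma heineWeight_insert (z : ℕ → ℂ) (μ : ℕ → ℝ) {a : ℕ} {P : Finset ℕ} (ha : a ∉ P) :
    heineWeight z μ (insert a P) =
      μ a * (∏ l ∈ P, ‖z a - z l‖ ^ 2) * heineWeight z μ P := by
  have h : ∀ c ∈ P, μ c * ∏ b ∈ (insert a P).erase c, ‖z b - z c‖ =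
      ‖z a - z c‖ * (μ c * ∏ b ∈ P.erase c, ‖z b - z c‖) := by
    intro c hc
    have hne : a ≠ c := fun h => ha (h ▸ hc)
    rw [Finset.erase_insert_of_ne hne,
      Finset.prod_insert (fun h => ha (Finset.mem_of_mem_erase h))]
    ring
  rw [heineWeight, Finset.prod_insert ha, Finset.erase_insert ha, Finset.prod_congr rfl h,
    Finset.prod_mul_distrib, heineWeight]
  have : ∏ b ∈ P, ‖z b - z a‖ = ∏ b ∈ P, ‖z a - z b‖ :=
    Finset.prod_congr rfl fun b _ => norm_sub_rev _ _
  rw [this, Finset.prod_pow]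
  ring

lemma heineWeight_pos {z : ℕ → ℂ} {μ : ℕ → ℝ} {S : Finset ℕ} (hz : Set.InjOn z S)
    (hμ : ∀ j ∈ S, 0 < μ j) : 0 < heineWeight z μ S := by
  refine Finset.prod_pos fun a ha => mul_pos (hμ a ha) (Finset.prod_pos fun b hb => ?_)
  obtain ⟨hne, hb⟩ := Finset.mem_erase.1 hb
  exact norm_pos_iff.2 (sub_ne_zero.2 fun h => hne (hz hb ha h))

/-- Heine's formula with exponentially evolving weights. -/
noncomputable def heineMean (n : ℕ) (z : ℕ → ℂ) (μ lam : ℕ → ℝ) (k : ℕ) (t : ℝ) : ℂ :=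
  tiltedMean (Finset.powersetCard k (Finset.Icc 1 n)) (heineWeight z μ)
    (fun S => ∑ j ∈ S, lam j) (fun S => ∏ j ∈ S, conj (z j)) t

/-- The two dominant subsets share {1, …, k-1}, whose weight cancels from the ratio. What remains of
the ratio, times the relative change of the product of conjugates, is the constant `xi`. -/
theorem heineMean_asymptotics {n k : ℕ} {z : ℕ → ℂ} {μ lam : ℕ → ℝ}
    (hz : Set.InjOn z (Set.Icc 1 n)) (hz1 : ∀ j ∈ Set.Icc 1 n, ‖z j‖ = 1)
    (hμ : ∀ j ∈ Set.Icc 1 n, 0 < μ j) (hlam : StrictAntiOn lam (Set.Icc 1 n))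
    (hk : 1 ≤ k) (hkn : k ≤ n - 1) :
    ∃ γ : ℝ, 0 < lam k - lam (k + 1) ∧ lam k - lam (k + 1) < γ ∧
      (fun t : ℝ => heineMean n z μ lam k t - (∏ j ∈ Finset.Icc 1 k, conj (z j)) *
        (1 + xi z μ k * (Real.exp (-(lam k - lam (k + 1)) * t) : ℂ)))
        =O[Filter.atTop] fun t : ℝ => Real.exp (-γ * t) := by
  have hkn : k + 1 ≤ n := by omega
  set P := Finset.Icc 1 (k - 1) with hP
  have hkP : insert k P = Finset.Icc 1 k := by
    ext x; simp only [hP, Finset.mem_insert, Finset.mem_Icc]; omega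
  have hk1P : k + 1 ∉ P := by simp only [hP, Finset.mem_Icc]; omega
  have hk0P : k ∉ P := by simp only [hP, Finset.mem_Icc]; omega
  have hPc : P.card = k - 1 := by simp [hP]
  have hPn : P ⊆ Finset.Icc 1 n := Finset.Icc_subset_Icc le_rfl (by omega)
  have hd : lam (k + 1) < lam k := hlam ⟨hk, by omega⟩ ⟨by omega, hkn⟩ (by omega)
  have m₀ : insert k P ∈ Finset.powersetCard k (Finset.Icc 1 n) := by
    rw [Finset.mem_powersetCard, Finset.card_insert_of_notMem hk0P, hPc]
    exact ⟨Finset.insert_subset (by simp; omega) hPn, by omega⟩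
  have m₁ : insert (k + 1) P ∈ Finset.powersetCard k (Finset.Icc 1 n) := by
    rw [Finset.mem_powersetCard, Finset.card_insert_of_notMem hk1P, hPc]
    exact ⟨Finset.insert_subset (by simp; omega) hPn, by omega⟩
  have hgap : ∑ j ∈ insert k P, lam j - ∑ j ∈ insert (k + 1) P, lam j =
      lam k - lam (k + 1) := by
    rw [Finset.sum_insert hk0P, Finset.sum_insert hk1P]; ring
  have hS : ∀ S ∈ Finset.powersetCard k (Finset.Icc 1 n), (S : Set ℕ) ⊆ Set.Icc 1 n :=
    fun S hS j hj => Finset.mem_Icc.1 ((Finset.mem_powersetCard.1 hS).1 hj)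
  obtain ⟨γ, hγ, hO⟩ := tiltedMean_asymptotics (Finset.powersetCard k (Finset.Icc 1 n)) m₀ m₁
    (heineWeight z μ) (fun S => ∑ j ∈ S, lam j) (fun S => ∏ j ∈ S, conj (z j))
    (fun S h => heineWeight_pos (hz.mono (hS S h)) fun j hj => hμ j (hS S h hj))
    (by have := sub_pos.2 hd; rw [← hgap] at this; linarith)
    (fun S h a b => sum_lt_of_card_eq hlam hk hkn (Finset.mem_powersetCard.1 h).1
      (Finset.mem_powersetCard.1 h).2 a b)
  rw [hgap] at hγ hO
  refine ⟨γ, by linarith, hγ, hO.congr_left fun t => ?_⟩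
  have hk1 : z k * conj (z k) = 1 := by
    rw [Complex.mul_conj, Complex.normSq_eq_norm_sq, hz1 k ⟨hk, by omega⟩]; simp
  have hw : heineWeight z μ (insert (k + 1) P) / heineWeight z μ (insert k P) =
      μ (k + 1) / μ k * ∏ l ∈ P, ‖(z (k + 1) - z l) / (z k - z l)‖ ^ 2 := by
    have hWP : heineWeight z μ P ≠ 0 := (heineWeight_pos
      (hz.mono fun j hj => Finset.mem_Icc.1 (hPn hj))
      fun j hj => hμ j (Finset.mem_Icc.1 (hPn hj))).ne'
    rw [heineWeight_insert z μ hk0P, heineWeight_insert z μ hk1P, mul_div_mul_right _ _ hWP,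
      mul_div_mul_comm, ← Finset.prod_div_distrib]
    simp only [norm_div, div_pow]
  have hb : ∏ j ∈ insert (k + 1) P, conj (z j) - ∏ j ∈ insert k P, conj (z j) =
      (∏ j ∈ Finset.Icc 1 k, conj (z j)) * (z k * conj (z (k + 1)) - 1) := by
    rw [← hkP, Finset.prod_insert hk0P, Finset.prod_insert hk1P]
    linear_combination (-(conj (z (k + 1)) * ∏ j ∈ P, conj (z j))) * hk1
  rw [hb, hw, hkP, heineMean, xi]
  push_cast
  ring

/-! ### The Cauchy–Binet formula -/

/-- The Cauchy–Binet formula. -/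
theorem det_sum_eq_sum_powersetCard {κ R : Type*} [LinearOrder κ] [CommRing R] (s : Finset κ)
    {k : ℕ} (a : Fin k → κ → R) (b : κ → Fin k → R) (g : Finset κ → R)
    (hg : ∀ (S : Finset κ) (h : S.card = k), S ⊆ s →
      g S = (Matrix.of fun i j => a i (S.orderEmbOfFin h j)).det *
        (Matrix.of fun i j => b (S.orderEmbOfFin h i) j).det) :
    (Matrix.of fun i j => ∑ l ∈ s, a i l * b l j).det = ∑ S ∈ Finset.powersetCard k s, g S := by
  -- Each row of the product is a combination of rows of `b`, so multilinearity gives a sum over all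
  -- maps `f`. Non-injective maps repeat a row, and the injective ones are grouped by their image.
  have h1 : (Matrix.of fun i j => ∑ l ∈ s, a i l * b l j).det =
      ∑ f ∈ Fintype.piFinset (fun _ : Fin k => s), (∏ i, a i (f i)) *
        (Matrix.of fun i j => b (f i) j).det := by
    have := (Matrix.detRowAlternating (n := Fin k) (R := R)).toMultilinearMap.map_sum_finset
      (fun i l => a i l • b l) (fun _ => s)
    have e : (Matrix.of fun i j => ∑ l ∈ s, a i l * b l j) =
        fun i => ∑ l ∈ s, a i l • b l := by
      ext i j; simp
    rw [e]
    refine this.trans (Finset.sum_congr rfl fun f _ => ?_)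
    rw [MultilinearMap.map_smul_univ]; rfl
  have h2 : ∑ f ∈ Fintype.piFinset (fun _ : Fin k => s), (∏ i, a i (f i)) *
        (Matrix.of fun i j => b (f i) j).det =
      ∑ f ∈ (Fintype.piFinset (fun _ : Fin k => s)).filter Function.Injective,
        (∏ i, a i (f i)) * (Matrix.of fun i j => b (f i) j).det := by
    refine (Finset.sum_filter_of_ne fun f _ hf => ?_).symm
    intro i j hij
    by_contra hne
    exact hf (by rw [Matrix.det_zero_of_row_eq hne (by ext l; simp [hij]), mul_zero])
  rw [h1, h2, ← Finset.sum_fiberwise_of_maps_to (t := Finset.powersetCard k s)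
    (g := fun f => Finset.univ.image f)]
  · refine Finset.sum_congr rfl fun S hS => ?_
    obtain ⟨hSs, hSc⟩ := Finset.mem_powersetCard.1 hS
    set e := S.orderEmbOfFin hSc with he
    have hrange : ∀ x ∈ S, ∃ i, e i = x := fun x hx => by
      have := Finset.range_orderEmbOfFin S hSc
      rw [← he] at this
      have hx : x ∈ Set.range e := by rw [this]; exact hx
      exact hx
    rw [hg S hSc hSs, ← he, ← Matrix.det_transpose (Matrix.of fun i j => a i (e j)),
      Matrix.det_apply, Finset.sum_mul]
    symm
    -- The maps with image `S` are the increasing enumeration of `S` composed with a permutation;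
    -- the sign from permuting the rows of `b` completes the Leibniz expansion of the minor of `a`.
    refine Finset.sum_bij (fun (σ : Equiv.Perm (Fin k)) _ => fun i => e (σ i)) ?_ ?_ ?_ ?_
    · intro σ _
      refine Finset.mem_filter.2 ⟨Finset.mem_filter.2 ⟨Fintype.mem_piFinset.2 fun i =>
        hSs (Finset.orderEmbOfFin_mem S hSc _), e.injective.comp σ.injective⟩, ?_⟩
      have : (Finset.univ.image fun i => e (σ i)) = Finset.univ.image e := by
        ext x
        simp only [Finset.mem_image, Finset.mem_univ, true_and]
        exact ⟨fun ⟨i, h⟩ => ⟨_, h⟩, fun ⟨i, h⟩ => ⟨σ.symm i, by simpa using h⟩⟩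
      rw [this]
      exact Finset.image_orderEmbOfFin_univ S hSc
    · intro σ _ τ _ h
      ext i
      exact congrArg Fin.val (e.injective (congrFun h i))
    · intro f hf
      obtain ⟨hf, hfS⟩ := Finset.mem_filter.1 hf
      obtain ⟨-, hinj⟩ := Finset.mem_filter.1 hf
      have hmem : ∀ i, f i ∈ S := fun i => hfS ▸ Finset.mem_image_of_mem f (Finset.mem_univ i)
      choose σ hσ using fun i => hrange _ (hmem i)
      have hσi : Function.Injective σ := fun i j h => hinj (by rw [← hσ, ← hσ, h])
      exact ⟨Equiv.ofBijective σ (Finite.injective_iff_bijective.1 hσi), Finset.mem_univ _,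
        funext fun i => hσ i⟩
    · intro σ _
      have := Matrix.det_permute σ (Matrix.of fun i j => b (e i) j)
      have e1 : (Matrix.of fun i j => b (e i) j).submatrix σ id =
        Matrix.of fun i j => b (e (σ i)) j := rfl
      rw [e1] at this
      rw [this]
      simp only [Matrix.transpose_apply, Matrix.of_apply, Units.smul_def, zsmul_eq_mul]
      ring
  · intro f hf
    obtain ⟨hf, hinj⟩ := Finset.mem_filter.1 hf
    rw [Finset.mem_powersetCard]
    refine ⟨fun x hx => ?_, by rw [Finset.card_image_of_injective _ hinj]; simp⟩
    obtain ⟨i, -, rfl⟩ := Finset.mem_image.1 hx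
    exact Fintype.mem_piFinset.1 hf i

/-! ### Block structure: determinants, truncation and unitarity -/

/-- The entries of `blockDiag`, for natural number indices. -/
noncomputable def blockEntry (α : ℕ → ℂ) (p i j : ℕ) : ℂ :=
  if i = j then
    if i % 2 = p % 2 then conj (α i) else -shifted α i
  else if j = i + 1 ∧ i % 2 = p % 2 then (rho α i : ℂ)
  else if i = j + 1 ∧ j % 2 = p % 2 then (rho α j : ℂ)
  else 0

lemma blockDiag_apply (n : ℕ) (α : ℕ → ℂ) (p : ℕ) (i j : Fin n) :
    blockDiag n α p i j = blockEntry α p i j := by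
  simp [blockDiag, blockEntry, Fin.ext_iff]

lemma blockEntry_self {α : ℕ → ℂ} {p i : ℕ} (h : i % 2 = p % 2) :
    blockEntry α p i i = conj (α i) := by simp [blockEntry, h]

lemma blockEntry_succ_self {α : ℕ → ℂ} {p i : ℕ} (h : i % 2 = p % 2) :
    blockEntry α p (i + 1) (i + 1) = -α i := by
  have : ¬ (i + 1) % 2 = p % 2 := by omega
  simp [blockEntry, this, shifted]

lemma blockEntry_zero_self {α : ℕ → ℂ} {p : ℕ} (h : p % 2 = 1) : blockEntry α p 0 0 = 1 := by
  simp [blockEntry, h, shifted]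

lemma blockEntry_self_succ {α : ℕ → ℂ} {p i : ℕ} (h : i % 2 = p % 2) :
    blockEntry α p i (i + 1) = rho α i := by simp [blockEntry, h]

lemma blockEntry_succ {α : ℕ → ℂ} {p i : ℕ} (h : i % 2 = p % 2) :
    blockEntry α p (i + 1) i = rho α i := by
  rw [blockEntry, if_neg (by omega), if_neg (by omega), if_pos ⟨rfl, h⟩]

lemma blockEntry_eq_zero {α : ℕ → ℂ} {p i j : ℕ} (h : i ≠ j)
    (h1 : ¬ (j = i + 1 ∧ i % 2 = p % 2)) (h2 : ¬ (i = j + 1 ∧ j % 2 = p % 2)) :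
    blockEntry α p i j = 0 := by
  simp [blockEntry, h, h1, h2]

lemma rho_sq {α : ℕ → ℂ} {k : ℕ} (h : ‖α k‖ ≤ 1) : (rho α k : ℂ) * rho α k = 1 - α k * conj (α k) := by
  rw [Complex.mul_conj, Complex.normSq_eq_norm_sq, ← Complex.ofReal_mul, rho,
    Real.mul_self_sqrt (by nlinarith [norm_nonneg (α k)])]
  push_cast; rfl

/-- The block `Ξ_k`. -/
noncomputable def Xi (α : ℕ → ℂ) (k : ℕ) : Matrix (Fin 2) (Fin 2) ℂ :=
  !![conj (α k), (rho α k : ℂ); (rho α k : ℂ), -α k]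

lemma det_Xi {α : ℕ → ℂ} {k : ℕ} (h : ‖α k‖ ≤ 1) : (Xi α k).det = -1 := by
  rw [Xi, Matrix.det_fin_two_of, rho_sq h]; ring

lemma Xi_unitary {α : ℕ → ℂ} {k : ℕ} (h : ‖α k‖ ≤ 1) : (Xi α k)ᴴ * Xi α k = 1 := by
  have := rho_sq h
  ext i j
  fin_cases i <;> fin_cases j <;>
    simp [Xi, Matrix.mul_apply, Fin.sum_univ_two, this] <;> ring

/-- Here the block starting at `k` is cut off by the matrix size, leaving only its upper left entry.
-/
lemma blockDiag_succ {k p : ℕ} (α : ℕ → ℂ) (h : k % 2 = p % 2) :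
    (blockDiag (k + 1) α p).submatrix finSumFinEquiv finSumFinEquiv =
      Matrix.fromBlocks (blockDiag k α p) 0 0 (Matrix.of fun _ _ : Fin 1 => conj (α k)) := by
  ext i j
  rcases i with i | i <;> rcases j with j | j
  · simp [blockDiag_apply]
  · obtain rfl : j = 0 := Subsingleton.elim _ _
    simp only [Matrix.submatrix_apply, blockDiag_apply, Matrix.fromBlocks_apply₁₂,
      finSumFinEquiv_apply_left, finSumFinEquiv_apply_right, Matrix.zero_apply]
    apply blockEntry_eq_zero <;> simp <;> omega
  · obtain rfl : i = 0 := Subsingleton.elim _ _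
    simp only [Matrix.submatrix_apply, blockDiag_apply, Matrix.fromBlocks_apply₂₁,
      finSumFinEquiv_apply_left, finSumFinEquiv_apply_right, Matrix.zero_apply]
    apply blockEntry_eq_zero <;> simp <;> omega
  · obtain rfl : i = 0 := Subsingleton.elim _ _
    obtain rfl : j = 0 := Subsingleton.elim _ _
    simp [blockDiag_apply, blockEntry_self h]

lemma blockDiag_add_two {k p : ℕ} (α : ℕ → ℂ) (h : k % 2 = p % 2) :
    (blockDiag (k + 2) α p).submatrix finSumFinEquiv finSumFinEquiv =
      Matrix.fromBlocks (blockDiag k α p) 0 0 (Xi α k) := by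
  ext i j
  rcases i with i | i <;> rcases j with j | j
  · simp [blockDiag_apply]
  · simp only [Matrix.submatrix_apply, blockDiag_apply, Matrix.fromBlocks_apply₁₂,
      finSumFinEquiv_apply_left, finSumFinEquiv_apply_right, Matrix.zero_apply]
    apply blockEntry_eq_zero <;> simp <;> omega
  · simp only [Matrix.submatrix_apply, blockDiag_apply, Matrix.fromBlocks_apply₂₁,
      finSumFinEquiv_apply_left, finSumFinEquiv_apply_right, Matrix.zero_apply]
    apply blockEntry_eq_zero <;> simp <;> omega
  · fin_cases i <;> fin_cases j <;>
    simp [blockDiag_apply, blockEntry_self h, blockEntry_succ h, blockEntry_self_succ h,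
      blockEntry_succ_self h, Xi]

lemma det_blockDiag_succ {k p : ℕ} (α : ℕ → ℂ) (h : k % 2 = p % 2) :
    (blockDiag (k + 1) α p).det = conj (α k) * (blockDiag k α p).det := by
  rw [← Matrix.det_submatrix_equiv_self finSumFinEquiv, blockDiag_succ α h,
    Matrix.det_fromBlocks_zero₁₂]
  simp [mul_comm]

lemma det_blockDiag_add_two {k p : ℕ} {α : ℕ → ℂ} (h : k % 2 = p % 2) (hα : ‖α k‖ ≤ 1) :
    (blockDiag (k + 2) α p).det = -(blockDiag k α p).det := by
  rw [← Matrix.det_submatrix_equiv_self finSumFinEquiv, blockDiag_add_two α h,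
    Matrix.det_fromBlocks_zero₁₂, det_Xi hα]
  simp

lemma blockDiag_add_two_parity (n : ℕ) (α : ℕ → ℂ) (p : ℕ) :
    blockDiag n α (p + 2) = blockDiag n α p := by
  simp [blockDiag]

lemma blockDiag_mod_two (n : ℕ) (α : ℕ → ℂ) (p : ℕ) :
    blockDiag n α (p % 2) = blockDiag n α p := by
  simp [blockDiag]

/-- Neither matrix has a truncated block at its end. Together they contain each of Ξ_0, …, Ξ_{k-1}
exactly once, and each has determinant -1. -/
lemma det_blockDiag_mul_succ {α : ℕ → ℂ} (k : ℕ) (hα : ∀ j < k, ‖α j‖ ≤ 1) :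
    (blockDiag k α k).det * (blockDiag (k + 1) α (k + 1)).det = (-1) ^ k := by
  induction k with
  | zero => simp [Matrix.det_fin_zero, blockDiag_apply, blockEntry_zero_self]
  | succ k ih =>
    have e : blockDiag (k + 1 + 1) α (k + 1 + 1) = blockDiag (k + 2) α k :=
      blockDiag_add_two_parity _ _ _
    rw [e, det_blockDiag_add_two rfl (hα k (by omega)), pow_succ,
      ← ih fun j hj => hα j (by omega)]
    ring

/-- One factor ends in the truncated entry conj α_k, and all other blocks are complete. Nothing is
assumed about |α_k|, so this also evaluates the leading minors of larger CMV matrices. -/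
lemma det_cmv {α : ℕ → ℂ} (k : ℕ) (hα : ∀ j < k, ‖α j‖ ≤ 1) :
    (cmv (k + 1) α).det = (-1) ^ k * conj (α k) := by
  have h1 : (cmv (k + 1) α).det =
      (blockDiag (k + 1) α k).det * (blockDiag (k + 1) α (k + 1)).det := by
    rw [cmv, Matrix.det_mul]
    rcases Nat.mod_two_eq_zero_or_one k with h | h
    · have h' : (k + 1) % 2 = 1 := by omega
      rw [← blockDiag_mod_two _ α k, ← blockDiag_mod_two _ α (k + 1), h, h']
    · have h' : (k + 1) % 2 = 0 := by omega
      rw [← blockDiag_mod_two _ α k, ← blockDiag_mod_two _ α (k + 1), h, h', mul_comm]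
  rw [h1, det_blockDiag_succ α rfl, ← det_blockDiag_mul_succ k hα]
  ring

/-- The cut before index k splits a block in at most one of 𝓛 and 𝓜. Hence no l ≥ k is linked to
indices below k on both sides, and truncation commutes with the product. -/
lemma cmv_submatrix {k n : ℕ} (h : k ≤ n) (α : ℕ → ℂ) :
    (cmv n α).submatrix (Fin.castLE h) (Fin.castLE h) = cmv k α := by
  ext i j
  simp only [cmv, Matrix.submatrix_apply, Matrix.mul_apply]
  rw [← Finset.sum_subset (Finset.subset_univ (Finset.univ.map (Fin.castLEEmb h)))]
  · simp [blockDiag_apply]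
  · intro l _ hl
    have hl : k ≤ l := by
      by_contra! hlt
      exact hl (Finset.mem_map.2 ⟨⟨l, hlt⟩, Finset.mem_univ _, rfl⟩)
    simp only [blockDiag_apply, Fin.val_castLE]
    have := i.2
    have := j.2
    rcases Nat.mod_two_eq_zero_or_one l with h0 | h0
    · rw [blockEntry_eq_zero (by omega) (by omega) (by omega), zero_mul]
    · rw [mul_comm, blockEntry_eq_zero (by omega) (by omega) (by omega), zero_mul]

/-- This is the case without a truncated last block, so no coefficient on the unit circle is needed.
-/
lemma blockDiag_unitary_of_parity {α : ℕ → ℂ} (p k : ℕ) (h : k % 2 = p % 2)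
    (hα : ∀ j, j + 1 < k → ‖α j‖ ≤ 1) : (blockDiag k α p)ᴴ * blockDiag k α p = 1 := by
  induction k using Nat.strong_induction_on with
  | _ k ih =>
    match k with
    | 0 => ext i; exact i.elim0
    | 1 =>
      have hp : p % 2 = 1 := by omega
      ext i j
      obtain rfl : i = 0 := Subsingleton.elim _ _
      obtain rfl : j = 0 := Subsingleton.elim _ _
      simp [Matrix.mul_apply, blockDiag_apply, blockEntry_zero_self hp]
    | k + 2 =>
      have hk : k % 2 = p % 2 := by omega
      apply Matrix.reindex finSumFinEquiv.symm finSumFinEquiv.symm |>.injective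
      simp only [Matrix.reindex_apply, Equiv.symm_symm]
      rw [← Matrix.submatrix_mul_equiv _ _ _ finSumFinEquiv, ← Matrix.conjTranspose_submatrix,
        blockDiag_add_two α hk, Matrix.fromBlocks_conjTranspose, Matrix.fromBlocks_multiply,
        ih k (by omega) hk fun j hj => hα j (by omega), Xi_unitary (hα k (by omega))]
      simp

lemma blockDiag_unitary {n : ℕ} (hn : 1 ≤ n) {α : ℕ → ℂ} (hα : IsVerblunsky n α) (p : ℕ) :
    (blockDiag n α p)ᴴ * blockDiag n α p = 1 := by
  have hα' : ∀ j, j + 1 < n → ‖α j‖ ≤ 1 := fun j hj => (hα.1 j hj).le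
  by_cases h : n % 2 = p % 2
  · exact blockDiag_unitary_of_parity p n h hα'
  · obtain ⟨k, rfl⟩ : ∃ k, n = k + 1 := ⟨n - 1, by omega⟩
    have hk : k % 2 = p % 2 := by omega
    have h1 : (Matrix.of fun _ _ : Fin 1 => conj (α k))ᴴ *
        (Matrix.of fun _ _ : Fin 1 => conj (α k)) = 1 := by
      have h2 : ‖α k‖ = 1 := hα.2
      ext i j
      obtain rfl : i = 0 := Subsingleton.elim _ _
      obtain rfl : j = 0 := Subsingleton.elim _ _
      simp [Matrix.mul_apply, Complex.mul_conj, Complex.normSq_eq_norm_sq, h2]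
    apply Matrix.reindex finSumFinEquiv.symm finSumFinEquiv.symm |>.injective
    simp only [Matrix.reindex_apply, Equiv.symm_symm]
    rw [← Matrix.submatrix_mul_equiv _ _ _ finSumFinEquiv, ← Matrix.conjTranspose_submatrix,
      blockDiag_succ α hk, Matrix.fromBlocks_conjTranspose, Matrix.fromBlocks_multiply,
      blockDiag_unitary_of_parity p k hk fun j hj => hα' j (by omega), h1]
    simp

lemma cmv_unitary {n : ℕ} (hn : 1 ≤ n) {α : ℕ → ℂ} (hα : IsVerblunsky n α) :
    (cmv n α)ᴴ * cmv n α = 1 := by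
  rw [cmv, Matrix.conjTranspose_mul, Matrix.mul_assoc, ← Matrix.mul_assoc (blockDiag n α 0)ᴴ,
    blockDiag_unitary hn hα, Matrix.one_mul, blockDiag_unitary hn hα]

/-! ### Eigenvectors of CMV matrices and Vandermonde minors -/

lemma blockDiag_mulVec {n p i : ℕ} (α : ℕ → ℂ) (h : i % 2 = p % 2) (hi : i + 1 < n)
    (x : Fin n → ℂ) :
    (blockDiag n α p *ᵥ x) ⟨i, by omega⟩ =
      conj (α i) * x ⟨i, by omega⟩ + rho α i * x ⟨i + 1, hi⟩ := by
  rw [Matrix.mulVec, dotProduct, Fintype.sum_eq_add ⟨i, by omega⟩ ⟨i + 1, hi⟩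
    (by rw [ne_eq, Fin.mk.injEq]; omega)]
  · simp [blockDiag_apply, blockEntry_self h, blockEntry_self_succ h]
  · rintro ⟨l, hl⟩ ⟨h1, h2⟩
    simp only [ne_eq, Fin.mk.injEq] at h1 h2
    rw [blockDiag_apply, blockEntry_eq_zero (by simp; omega) (by simp; omega) (by simp; omega),
      zero_mul]

lemma blockDiag_mulVec_succ {n p i : ℕ} (α : ℕ → ℂ) (h : i % 2 = p % 2) (hi : i + 1 < n)
    (x : Fin n → ℂ) :
    (blockDiag n α p *ᵥ x) ⟨i + 1, hi⟩ =
      rho α i * x ⟨i, by omega⟩ - α i * x ⟨i + 1, hi⟩ := by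
  rw [Matrix.mulVec, dotProduct, Fintype.sum_eq_add ⟨i, by omega⟩ ⟨i + 1, hi⟩
    (by rw [ne_eq, Fin.mk.injEq]; omega)]
  · simp [blockDiag_apply, blockEntry_succ h, blockEntry_succ_self h]; ring
  · rintro ⟨l, hl⟩ ⟨h1, h2⟩
    simp only [ne_eq, Fin.mk.injEq] at h1 h2
    rw [blockDiag_apply, blockEntry_eq_zero (by simp; omega) (by simp; omega) (by simp; omega),
      zero_mul]

lemma blockDiag_mulVec_zero {n : ℕ} (α : ℕ → ℂ) (hn : 0 < n) (x : Fin n → ℂ) :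
    (blockDiag n α 1 *ᵥ x) ⟨0, hn⟩ = x ⟨0, hn⟩ := by
  rw [Matrix.mulVec, dotProduct, Fintype.sum_eq_single ⟨0, hn⟩]
  · simp [blockDiag_apply, blockEntry_zero_self]
  · rintro ⟨l, hl⟩ h1
    simp only [ne_eq, Fin.mk.injEq] at h1
    rw [blockDiag_apply, blockEntry_eq_zero (by simp; omega) (by simp) (by simp), zero_mul]

lemma rho_ne_zero {α : ℕ → ℂ} {k : ℕ} (h : ‖α k‖ < 1) : (rho α k : ℂ) ≠ 0 := by
  have : 0 < rho α k := Real.sqrt_pos.2 (by nlinarith [norm_nonneg (α k)])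
  exact_mod_cast this.ne'

open Polynomial in
/-- The components of an eigenvector of a CMV matrix are the first component times Laurent
polynomials in the eigenvalue. -/
lemma exists_laurent {n : ℕ} {α : ℕ → ℂ} (hα : IsVerblunsky n α) (i : ℕ) (hi : i < n) :
    ∃ p q : ℂ[X], p.natDegree ≤ i ∧ q.natDegree ≤ i ∧ ∀ (z : ℂ) (v : Fin n → ℂ), z ≠ 0 →
      cmv n α *ᵥ v = z • v →
      z ^ ((i + 1) / 2) * v ⟨i, hi⟩ = p.eval z * v ⟨0, by omega⟩ ∧
      z ^ (i / 2) * (blockDiag n α 1 *ᵥ v) ⟨i, hi⟩ = q.eval z * v ⟨0, by omega⟩ := by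
  induction i with
  | zero =>
    refine ⟨1, 1, by simp, by simp, fun z v _ _ => ?_⟩
    simp [blockDiag_mulVec_zero]
  | succ i ih =>
    obtain ⟨p, q, hp, hq, h⟩ := ih (by omega)
    have hρ := rho_ne_zero (hα.1 i hi)
    have hρ2 := rho_sq (hα.1 i hi).le
    set r : ℂ := ((rho α i : ℝ) : ℂ) with hr
    have deg : ∀ (a b c : ℂ) (p q : ℂ[X]), p.natDegree ≤ i → q.natDegree ≤ i →
        (C a * (C b * p - C c * (X * q))).natDegree ≤ i + 1 := by
      intro a b c p q hp hq
      refine (natDegree_C_mul_le _ _).trans ((natDegree_sub_le _ _).trans (max_le ?_ ?_))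
      · exact (natDegree_C_mul_le _ _).trans (by omega)
      · refine (natDegree_C_mul_le _ _).trans (natDegree_mul_le.trans ?_)
        have := natDegree_X_le (R := ℂ)
        omega
    -- With w = 𝓜v, the eigenvalue equation reads 𝓛w = zv. The block Ξ_i lies in 𝓛 for even i and in
    -- 𝓜 for odd i; since ρ_i ≠ 0 it can be solved for the components i + 1 of v and w. This is a
    -- Szegő recursion, and the powers of z clear its negative exponents.
    rcases Nat.mod_two_eq_zero_or_one i with h0 | h0
    · refine ⟨C r⁻¹ * (C 1 * q - C (α i) * (X * p)), C r⁻¹ * (C (-conj (α i)) * q - C (-1) * (X * p)),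
        deg _ _ _ _ _ hq hp, deg _ _ _ _ _ hq hp, fun z v hz hv => ?_⟩
      obtain ⟨h1, h2⟩ := h z v hz hv
      set w := blockDiag n α 1 *ᵥ v with hw
      have hL : blockDiag n α 0 *ᵥ w = z • v := by
        rw [hw, Matrix.mulVec_mulVec, ← hv, cmv]
      have e1 := congrFun hL ⟨i, by omega⟩
      have e2 := congrFun hL ⟨i + 1, hi⟩
      rw [blockDiag_mulVec (p := 0) α (by omega) hi, ← hr] at e1
      rw [blockDiag_mulVec_succ (p := 0) α (by omega) hi, ← hr] at e2
      simp only [Pi.smul_apply, smul_eq_mul] at e1 e2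
      have i1 : (i + 1 + 1) / 2 = i / 2 + 1 := by omega
      have i2 : (i + 1) / 2 = i / 2 := by omega
      rw [i1, i2]
      rw [i2] at h1
      simp only [eval_mul, eval_sub, eval_C, eval_X]
      constructor
      · refine mul_left_cancel₀ hρ ?_
        field_simp
        linear_combination h2 - α i * z * h1 - α i * z ^ (i / 2) * e1 - r * z ^ (i / 2) * e2
          + z ^ (i / 2) * w ⟨i, by omega⟩ * hρ2
      · refine mul_left_cancel₀ hρ ?_
        field_simp
        linear_combination z ^ (i / 2) * e1 + z * h1 - conj (α i) * h2
    · refine ⟨C r⁻¹ * (C (-conj (α i)) * p - C (-1) * (X * q)), C r⁻¹ * (C 1 * p - C (α i) * (X * q)),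
        deg _ _ _ _ _ hp hq, deg _ _ _ _ _ hp hq, fun z v hz hv => ?_⟩
      obtain ⟨h1, h2⟩ := h z v hz hv
      have e1 := blockDiag_mulVec (p := 1) α (by omega) hi v
      have e2 := blockDiag_mulVec_succ (p := 1) α (by omega) hi v
      set w := blockDiag n α 1 *ᵥ v with hw
      rw [← hr] at e1 e2
      have i1 : (i + 1 + 1) / 2 = i / 2 + 1 := by omega
      have i2 : (i + 1) / 2 = i / 2 + 1 := by omega
      rw [i1, i2]
      rw [i2] at h1
      simp only [eval_mul, eval_sub, eval_C, eval_X]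
      constructor
      · refine mul_left_cancel₀ hρ ?_
        field_simp
        linear_combination -z ^ (i / 2 + 1) * e1 + z * h2 - conj (α i) * h1
      · refine mul_left_cancel₀ hρ ?_
        field_simp
        linear_combination h1 - α i * z * h2 + α i * z ^ (i / 2 + 1) * e1
          + r * z ^ (i / 2 + 1) * e2 + z ^ (i / 2 + 1) * v ⟨i, by omega⟩ * hρ2

/-- By the recursion the first component determines all others; this makes every spectral mass
positive. -/
lemma eigenvector_zero_ne_zero {n : ℕ} (hn : 1 ≤ n) {α : ℕ → ℂ} (hα : IsVerblunsky n α) {z : ℂ}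
    {v : Fin n → ℂ} (hz : z ≠ 0) (hv : cmv n α *ᵥ v = z • v) (hv0 : v ≠ 0) :
    v ⟨0, hn⟩ ≠ 0 := by
  intro h
  apply hv0
  ext ⟨i, hi⟩
  obtain ⟨p, q, -, -, hpq⟩ := exists_laurent hα i hi
  have := (hpq z v hz hv).1
  rw [h, mul_zero] at this
  simpa [hz] using this

open Polynomial in
/-- Up to a factor that depends only on the matrix, the minors of the first `k` rows of a matrix of
eigenvectors are Vandermonde determinants. -/
lemma exists_minor_eq {n k : ℕ} (hn : 1 ≤ n) (hk : k ≤ n) {α : ℕ → ℂ} (hα : IsVerblunsky n α) :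
    ∃ c : ℝ, ∀ (z : Fin k → ℂ) (v : Fin k → Fin n → ℂ), (∀ j, ‖z j‖ = 1) →
      (∀ j, cmv n α *ᵥ v j = z j • v j) →
      ‖(Matrix.of fun i j => v j (Fin.castLE hk i)).det‖ ^ 2 =
        c * (‖(Matrix.vandermonde z).det‖ ^ 2 * ∏ j, ‖v j ⟨0, hn⟩‖ ^ 2) := by
  choose p q hp _ hpq using exists_laurent hα
  -- All rows are brought to the common power z^{k/2}, which keeps the degrees below k. The factor
  -- is invisible in modulus because |z| = 1, and the coefficient matrix `T` depends only on `α`.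
  let P : Fin k → ℂ[X] := fun i => X ^ (k / 2 - (i + 1) / 2) * p i (by omega)
  have hP : ∀ i, (P i).natDegree < k := fun i => by
    have h1 := hp i (by omega)
    have h2 := i.2
    refine lt_of_le_of_lt natDegree_mul_le ?_
    rw [natDegree_X_pow]
    omega
  let T : Matrix (Fin k) (Fin k) ℂ := Matrix.of fun i l => (P i).coeff l
  refine ⟨‖T.det‖ ^ 2, fun z v hz hv => ?_⟩
  have key : Matrix.of (fun i j => v j (Fin.castLE hk i)) * Matrix.diagonal (fun j => z j ^ (k / 2)) =
      T * (Matrix.vandermonde z)ᵀ * Matrix.diagonal (fun j => v j ⟨0, hn⟩) := by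
    ext i j
    have hzj : z j ≠ 0 := norm_ne_zero_iff.1 (by rw [hz j]; exact one_ne_zero)
    rw [Matrix.mul_diagonal, Matrix.mul_diagonal, Matrix.mul_apply]
    have e1 : ∑ l, T i l * (Matrix.vandermonde z)ᵀ l j = (P i).eval (z j) := by
      rw [eval_eq_sum_range' (hP i), ← Fin.sum_univ_eq_sum_range
        (fun l => (P i).coeff l * z j ^ l) k]
      rfl
    have e2 := (hpq i (by omega) (z j) (v j) hzj (hv j)).1
    have e3 : z j ^ (k / 2) = z j ^ (k / 2 - (i + 1) / 2) * z j ^ (((i : ℕ) + 1) / 2) := by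
      rw [← pow_add]; congr 1; omega
    rw [e1]
    simp only [P, eval_mul, eval_pow, eval_X, Matrix.of_apply]
    rw [e3, mul_assoc _ _ (v j ⟨0, hn⟩), ← e2]
    simp only [Fin.castLE]
    ring
  have hdet := congrArg (fun M : Matrix (Fin k) (Fin k) ℂ => ‖M.det‖ ^ 2) key
  simp only [Matrix.det_mul, Matrix.det_diagonal, Matrix.det_transpose, norm_mul, norm_prod,
    norm_pow, hz, one_pow, Finset.prod_const_one, mul_one] at hdet
  rw [hdet, Finset.prod_pow]
  ring

/-- The product over ordered pairs counts each unordered pair twice, which matches the square. -/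
lemma norm_det_vandermonde_sq {z : ℕ → ℂ} {k : ℕ} {S : Finset ℕ} (h : S.card = k) :
    ‖(Matrix.vandermonde fun i => z (S.orderEmbOfFin h i)).det‖ ^ 2 =
      ∏ a ∈ S, ∏ b ∈ S.erase a, ‖z b - z a‖ := by
  set e := S.orderEmbOfFin h with he
  have hS : S = Finset.univ.map e.toEmbedding := (Finset.map_orderEmbOfFin_univ S h).symm
  have h1 : ∏ a ∈ S, ∏ b ∈ S.erase a, ‖z b - z a‖ =
      ∏ i, ∏ j ∈ {i}ᶜ, ‖z (e j) - z (e i)‖ := by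
    conv_lhs => rw [hS]
    rw [Finset.prod_map]
    refine Finset.prod_congr rfl fun i _ => ?_
    rw [← Finset.map_erase, Finset.prod_map, Finset.compl_singleton]
    rfl
  rw [h1, ← Finset.prod_prod_Ioi_mul_eq_prod_prod_off_diag, Matrix.det_vandermonde, norm_prod,
    ← Finset.prod_pow]
  refine Finset.prod_congr rfl fun i _ => ?_
  rw [norm_prod, ← Finset.prod_pow]
  refine Finset.prod_congr rfl fun j _ => ?_
  rw [norm_sub_rev (z (e i)), sq]

/-! ### Orthonormal eigenbases and spectral masses -/

/-- `v 1, …, v n` is an orthonormal basis of eigenvectors of `C`, for the eigenvalues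
`z 1, …, z n`. -/
structure IsEigenbasis {n : ℕ} (C : Matrix (Fin n) (Fin n) ℂ) (z : ℕ → ℂ)
    (v : ℕ → Fin n → ℂ) : Prop where
  eigen : ∀ j ∈ Finset.Icc 1 n, C *ᵥ v j = z j • v j
  orthonormal : ∀ i ∈ Finset.Icc 1 n, ∀ j ∈ Finset.Icc 1 n,
    star (v i) ⬝ᵥ v j = if i = j then 1 else 0
  resolution : ∀ i i', ∑ j ∈ Finset.Icc 1 n, v j i * conj (v j i') = if i = i' then 1 else 0

lemma star_mulVec_dotProduct_mulVec {n : ℕ} {C : Matrix (Fin n) (Fin n) ℂ} (hC : Cᴴ * C = 1)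
    (v x : Fin n → ℂ) : star (C *ᵥ v) ⬝ᵥ (C *ᵥ x) = star v ⬝ᵥ x := by
  rw [Matrix.star_mulVec, Matrix.dotProduct_mulVec, Matrix.vecMul_vecMul, hC, Matrix.vecMul_one]

open scoped ComplexOrder in
lemma norm_eigenvalue {n : ℕ} {C : Matrix (Fin n) (Fin n) ℂ} (hC : Cᴴ * C = 1) {z : ℂ}
    {v : Fin n → ℂ} (hv : C *ᵥ v = z • v) (hv0 : v ≠ 0) : ‖z‖ = 1 := by
  have h := star_mulVec_dotProduct_mulVec hC v v
  rw [hv, star_smul, smul_dotProduct, dotProduct_smul, smul_smul, smul_eq_mul] at h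
  have h0 : star v ⬝ᵥ v ≠ 0 := fun h => hv0 (dotProduct_star_self_eq_zero.1 h)
  have h1 : star z * z = 1 := mul_right_cancel₀ h0 (by rw [h, one_mul])
  have h2 : ‖z‖ * ‖z‖ = 1 := by
    have := congrArg norm h1
    rwa [norm_mul, norm_star, norm_one] at this
  nlinarith [norm_nonneg z]

lemma eigenvectors_orthogonal {n : ℕ} {C : Matrix (Fin n) (Fin n) ℂ} (hC : Cᴴ * C = 1) {z w : ℂ}
    {v x : Fin n → ℂ} (hz : ‖z‖ = 1) (hzw : z ≠ w) (hv : C *ᵥ v = z • v) (hx : C *ᵥ x = w • x) :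
    star v ⬝ᵥ x = 0 := by
  have h := star_mulVec_dotProduct_mulVec hC v x
  rw [hv, hx, star_smul, smul_dotProduct, dotProduct_smul, smul_smul, smul_eq_mul] at h
  by_contra h0
  have h1 : star z * w = 1 := mul_right_cancel₀ h0 (by rw [h, one_mul])
  have h2 : z * star z = 1 := by
    rw [Complex.star_def, Complex.mul_conj, Complex.normSq_eq_norm_sq, hz]; simp
  exact hzw (by linear_combination (-z) * h1 + w * h2)

lemma sum_fin_succ_eq_sum_Icc {M : Type*} [AddCommMonoid M] (n : ℕ) (g : ℕ → M) :
    ∑ j : Fin n, g (j + 1) = ∑ j ∈ Finset.Icc 1 n, g j := by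
  rw [Fin.sum_univ_eq_sum_range (fun j => g (j + 1)) n, Finset.range_eq_Ico,
    Finset.sum_Ico_add' g 0 n 1]
  refine Finset.sum_congr ?_ fun _ _ => rfl
  ext x; simp only [Finset.mem_Ico, Finset.mem_Icc]; omega

lemma mem_spectrum_iff_exists {n : ℕ} {C : Matrix (Fin n) (Fin n) ℂ} {w : ℂ} :
    w ∈ spectrum ℂ C ↔ ∃ v : Fin n → ℂ, v ≠ 0 ∧ C *ᵥ v = w • v := by
  rw [← Matrix.spectrum_toLin', ← Module.End.hasEigenvalue_iff_mem_spectrum]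
  constructor
  · intro h
    obtain ⟨v, hv⟩ := h.exists_hasEigenvector
    exact ⟨v, hv.2, by simpa using hv.apply_eq_smul⟩
  · rintro ⟨v, hv0, hv⟩
    exact Module.End.hasEigenvalue_of_hasEigenvector
      ⟨Module.End.mem_eigenspace_iff.2 (by simpa using hv), hv0⟩

theorem exists_isEigenbasis {n : ℕ} {C : Matrix (Fin n) (Fin n) ℂ} (hC : Cᴴ * C = 1) {z : ℕ → ℂ}
    (hz : spectrum ℂ C = z '' Set.Icc 1 n) (hinj : Set.InjOn z (Set.Icc 1 n)) :
    ∃ v, IsEigenbasis C z v := by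
  have h1 : ∀ j, ∃ v : Fin n → ℂ, j ∈ Finset.Icc 1 n → C *ᵥ v = z j • v ∧ star v ⬝ᵥ v = 1 := by
    intro j
    by_cases hj : j ∈ Finset.Icc 1 n
    · obtain ⟨u, hu0, hu⟩ := mem_spectrum_iff_exists.1
        (hz ▸ Set.mem_image_of_mem z (Finset.mem_Icc.1 hj) : z j ∈ spectrum ℂ C)
      set x := WithLp.toLp 2 u with hx
      have hx0 : ‖x‖ ≠ 0 := norm_ne_zero_iff.2 fun h => hu0 (by
        have := congrArg WithLp.ofLp h
        simpa [hx] using this)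
      have hnorm : star u ⬝ᵥ u = ((‖x‖ ^ 2 : ℝ) : ℂ) := by
        rw [EuclideanSpace.norm_sq_eq]
        simp only [dotProduct, Pi.star_apply, Complex.star_def, hx]
        push_cast
        refine Finset.sum_congr rfl fun i _ => ?_
        rw [mul_comm, Complex.mul_conj, Complex.normSq_eq_norm_sq]; push_cast; rfl
      refine ⟨((‖x‖⁻¹ : ℝ) : ℂ) • u, fun _ => ⟨?_, ?_⟩⟩
      · rw [Matrix.mulVec_smul, hu, smul_comm]
      · rw [star_smul, smul_dotProduct, dotProduct_smul, hnorm, smul_eq_mul, smul_eq_mul,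
          Complex.star_def, Complex.conj_ofReal, ← Complex.ofReal_mul, ← Complex.ofReal_mul]
        norm_cast
        field_simp
    · exact ⟨0, fun h => absurd h hj⟩
  choose v hv using h1
  have hne : ∀ j ∈ Finset.Icc 1 n, v j ≠ 0 := fun j hj h => by
    have := (hv j hj).2
    rw [h] at this
    simp at this
  have horth : ∀ i ∈ Finset.Icc 1 n, ∀ j ∈ Finset.Icc 1 n,
      star (v i) ⬝ᵥ v j = if i = j then 1 else 0 := by
    intro i hi j hj
    by_cases h : i = j
    · rw [← h, if_pos rfl, (hv i hi).2]
    · rw [if_neg h]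
      exact eigenvectors_orthogonal hC (norm_eigenvalue hC (hv i hi).1 (hne i hi))
        (fun h' => h (hinj (Finset.mem_Icc.1 hi) (Finset.mem_Icc.1 hj) h')) (hv i hi).1 (hv j hj).1
  refine ⟨v, fun j hj => (hv j hj).1, horth, ?_⟩
  -- Orthonormality of the columns of a square matrix implies that of its rows, which is the
  -- resolution of the identity.
  let U : Matrix (Fin n) (Fin n) ℂ := Matrix.of fun i j => v (j + 1) i
  have hU : Uᴴ * U = 1 := by
    ext i j
    rw [Matrix.mul_apply, Matrix.one_apply]
    have := horth (i + 1) (by simp) (j + 1) (by simp)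
    rw [dotProduct] at this
    simp only [add_left_inj, ← Fin.ext_iff] at this
    exact this
  have hU' : U * Uᴴ = 1 := mul_eq_one_comm.1 hU
  intro i i'
  have := congrFun (congrFun hU' i) i'
  rw [Matrix.mul_apply, Matrix.one_apply] at this
  rw [← sum_fin_succ_eq_sum_Icc n (fun j => v j i * conj (v j i'))]
  exact this

namespace IsEigenbasis

variable {n : ℕ} {C : Matrix (Fin n) (Fin n) ℂ} {z : ℕ → ℂ} {v : ℕ → Fin n → ℂ}

lemma ne_zero (h : IsEigenbasis C z v) {j : ℕ} (hj : j ∈ Finset.Icc 1 n) : v j ≠ 0 := fun h0 => by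
  have := h.orthonormal j hj j hj
  rw [h0] at this
  simp at this

lemma norm_eq_one (h : IsEigenbasis C z v) (hC : Cᴴ * C = 1) {j : ℕ} (hj : j ∈ Finset.Icc 1 n) :
    ‖z j‖ = 1 :=
  norm_eigenvalue hC (h.eigen j hj) (h.ne_zero hj)

lemma apply_eq (h : IsEigenbasis C z v) {D : Matrix (Fin n) (Fin n) ℂ} {d : ℕ → ℂ}
    (hD : ∀ j ∈ Finset.Icc 1 n, D *ᵥ v j = d j • v j) (i i' : Fin n) :
    D i i' = ∑ j ∈ Finset.Icc 1 n, d j * v j i * conj (v j i') := by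
  have h1 : ∀ j ∈ Finset.Icc 1 n, d j * v j i * conj (v j i') =
      ∑ l, D i l * (v j l * conj (v j i')) := by
    intro j hj
    have := congrFun (hD j hj) i
    simp only [Matrix.mulVec, dotProduct, Pi.smul_apply, smul_eq_mul] at this
    rw [← this, Finset.sum_mul]
    exact Finset.sum_congr rfl fun l _ => by ring
  rw [Finset.sum_congr rfl h1, Finset.sum_comm]
  simp only [← Finset.mul_sum, h.resolution]
  simp

lemma aeval_mulVec (h : IsEigenbasis C z v) (p : Polynomial ℂ) {j : ℕ}
    (hj : j ∈ Finset.Icc 1 n) : Polynomial.aeval C p *ᵥ v j = p.eval (z j) • v j := by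
  induction p using Polynomial.induction_on' with
  | add p q hp hq => rw [map_add, Matrix.add_mulVec, hp, hq, Polynomial.eval_add, add_smul]
  | monomial m a =>
    rw [Polynomial.aeval_monomial, Polynomial.eval_monomial, ← Algebra.smul_def,
      Matrix.smul_mulVec, mul_smul]
    congr 1
    induction m with
    | zero => simp
    | succ m ih =>
      rw [pow_succ', ← Matrix.mulVec_mulVec, ih, Matrix.mulVec_smul, h.eigen j hj, smul_smul,
        pow_succ]

/-- Distinct eigenvalues make the eigenspace the line through `v j`, so projecting e₁ leaves the
first component of that unit vector, in modulus. -/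
lemma spectralMass_eq (h : IsEigenbasis C z v) (hC : Cᴴ * C = 1)
    (hinj : Set.InjOn z (Set.Icc 1 n)) (hn : 1 ≤ n) {j : ℕ} (hj : j ∈ Finset.Icc 1 n) :
    spectralMass C (z j) = ‖v j ⟨0, hn⟩‖ ^ 2 := by
  set u : EuclideanSpace ℂ (Fin n) := WithLp.toLp 2 (v j) with hu
  have hunorm : ‖u‖ = 1 := by
    have h1 : ((‖u‖ ^ 2 : ℝ) : ℂ) = 1 := by
      rw [EuclideanSpace.norm_sq_eq, ← if_pos (c := j = j) rfl (t := (1 : ℂ)) (e := 0),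
        ← h.orthonormal j hj j hj]
      simp only [dotProduct, Pi.star_apply, Complex.star_def, hu]
      push_cast
      refine Finset.sum_congr rfl fun i _ => ?_
      rw [mul_comm, Complex.mul_conj, Complex.normSq_eq_norm_sq]; push_cast; rfl
    have h2 : ‖u‖ ^ 2 = 1 := by exact_mod_cast h1
    nlinarith [norm_nonneg u]
  have hE : Module.End.eigenspace (Matrix.toEuclideanLin C) (z j) = Submodule.span ℂ {u} := by
    ext x
    rw [Module.End.mem_eigenspace_iff, Submodule.mem_span_singleton]
    constructor
    · intro hx
      have hx' : C *ᵥ x.ofLp = z j • x.ofLp := by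
        have := congrArg WithLp.ofLp hx
        simpa using this
      refine ⟨star (v j) ⬝ᵥ x.ofLp, ?_⟩
      ext i
      have h1 : x i = ∑ l ∈ Finset.Icc 1 n, v l i * (star (v l) ⬝ᵥ x.ofLp) := by
        have : x i = ∑ i', (if i = i' then 1 else 0) * x i' := by simp
        rw [this]
        simp only [← h.resolution, Finset.sum_mul, dotProduct, Finset.mul_sum]
        rw [Finset.sum_comm]
        refine Finset.sum_congr rfl fun l _ => Finset.sum_congr rfl fun i' _ => ?_
        simp only [Pi.star_apply, Complex.star_def]
        ring
      rw [h1, Finset.sum_eq_single_of_mem j hj]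
      · simp [hu, mul_comm]
      · intro l hl hlj
        rw [eigenvectors_orthogonal hC (h.norm_eq_one hC hl)
          (fun e => hlj (hinj (Finset.mem_Icc.1 hl) (Finset.mem_Icc.1 hj) e)) (h.eigen l hl) hx',
          mul_zero]
    · rintro ⟨a, rfl⟩
      rw [map_smul, smul_comm]
      congr 1
      apply WithLp.ofLp_injective
      simpa [hu] using h.eigen j hj
  rw [spectralMass]
  have hproj : (Module.End.eigenspace (Matrix.toEuclideanLin C) (z j)).starProjection (e1 n) =
      (Submodule.span ℂ {u}).starProjection (e1 n) := by
    congr 1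
    simp only [hE]
  rw [hproj, Submodule.starProjection_unit_singleton ℂ hunorm, norm_smul, hunorm, mul_one]
  have : inner ℂ u (e1 n) = conj (v j ⟨0, hn⟩) := by
    rw [EuclideanSpace.inner_eq_star_dotProduct, dotProduct, Fintype.sum_eq_single ⟨0, hn⟩]
    · simp [e1, hu]
    · rintro ⟨i, hi⟩ hi0
      simp only [ne_eq, Fin.mk.injEq] at hi0
      simp [e1, hi0]
  rw [this, RCLike.norm_conj]

end IsEigenbasis

/-! ### Heine's formula -/

/-- Heine's formula for the Verblunsky coefficients. -/
theorem heine {n k : ℕ} (hn : 1 ≤ n) (hk : k + 1 ≤ n) {α : ℕ → ℂ} (hα : IsVerblunsky n α)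
    {z : ℕ → ℂ} {v : ℕ → Fin n → ℂ} (h : IsEigenbasis (cmv n α) z v) :
    α k = (-1) ^ k * ((∑ S ∈ Finset.powersetCard (k + 1) (Finset.Icc 1 n), (∏ j ∈ S, conj (z j)) *
        (heineWeight z (fun j => ‖v j ⟨0, hn⟩‖ ^ 2) S : ℂ)) /
        ((∑ S ∈ Finset.powersetCard (k + 1) (Finset.Icc 1 n),
          heineWeight z (fun j => ‖v j ⟨0, hn⟩‖ ^ 2) S : ℝ) : ℂ)) := by
  set W := heineWeight z (fun j => ‖v j ⟨0, hn⟩‖ ^ 2) with hW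
  obtain ⟨c, hc⟩ := exists_minor_eq hn hk hα
  have hminor : ∀ (S : Finset ℕ) (hS : S.card = k + 1), S ⊆ Finset.Icc 1 n →
      (Matrix.of fun i j => v (S.orderEmbOfFin hS j) (Fin.castLE hk i)).det *
        (Matrix.of fun i j => conj (v (S.orderEmbOfFin hS i) (Fin.castLE hk j))).det =
      ((c * W S : ℝ) : ℂ) := by
    intro S hS hSn
    have e1 : (Matrix.of fun i j => conj (v (S.orderEmbOfFin hS i) (Fin.castLE hk j))).det =
        conj (Matrix.of fun i j => v (S.orderEmbOfFin hS j) (Fin.castLE hk i)).det := by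
      rw [← Complex.star_def, ← Matrix.det_conjTranspose]
      rfl
    have hmem : ∀ j, S.orderEmbOfFin hS j ∈ Finset.Icc 1 n := fun j =>
      hSn (Finset.orderEmbOfFin_mem S hS j)
    rw [e1, Complex.mul_conj, Complex.normSq_eq_norm_sq,
      hc (fun j => z (S.orderEmbOfFin hS j)) (fun j => v (S.orderEmbOfFin hS j))
        (fun j => h.norm_eq_one (cmv_unitary hn hα) (hmem j)) (fun j => h.eigen _ (hmem j)),
      norm_det_vandermonde_sq hS, hW, heineWeight, Finset.prod_mul_distrib]
    have e2 : ∏ j, ‖v (S.orderEmbOfFin hS j) ⟨0, hn⟩‖ ^ 2 = ∏ a ∈ S, ‖v a ⟨0, hn⟩‖ ^ 2 := by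
      conv_rhs => rw [← Finset.map_orderEmbOfFin_univ S hS, Finset.prod_map]
      rfl
    rw [e2, mul_comm (∏ a ∈ S, ‖v a ⟨0, hn⟩‖ ^ 2)]
  -- Cauchy–Binet for the leading block of the identity matrix determines the unknown constant `c`:
  -- it normalises the weights to total mass 1.
  have hone : (1 : ℂ) = ((c * ∑ S ∈ Finset.powersetCard (k + 1) (Finset.Icc 1 n), W S : ℝ) : ℂ) := by
    have := det_sum_eq_sum_powersetCard (Finset.Icc 1 n)
      (fun (i : Fin (k + 1)) l => v l (Fin.castLE hk i))
      (fun l (i : Fin (k + 1)) => conj (v l (Fin.castLE hk i)))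
      (fun S => ((c * W S : ℝ) : ℂ)) (fun S hS hSn => (hminor S hS hSn).symm)
    rw [Finset.mul_sum, Complex.ofReal_sum, ← this]
    simp only [h.resolution]
    rw [← Matrix.det_one (n := Fin (k + 1)) (R := ℂ)]
    congr 1
    ext i j
    simp [Matrix.one_apply, Fin.ext_iff]
  -- The same expansion for the leading block of the CMV matrix: the eigenvalues scale the columns
  -- of the eigenvector minors and add a factor ∏ z_j.
  have hdet : (-1) ^ k * conj (α k) =
      c * ∑ S ∈ Finset.powersetCard (k + 1) (Finset.Icc 1 n), (∏ j ∈ S, z j) * (W S : ℂ) := by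
    have := det_sum_eq_sum_powersetCard (Finset.Icc 1 n)
      (fun (i : Fin (k + 1)) l => v l (Fin.castLE hk i) * z l)
      (fun l (i : Fin (k + 1)) => conj (v l (Fin.castLE hk i)))
      (fun S => (∏ j ∈ S, z j) * ((c * W S : ℝ) : ℂ)) (fun S hS hSn => by
        have e : (Matrix.of fun i j => v (S.orderEmbOfFin hS j) (Fin.castLE hk i) *
            z (S.orderEmbOfFin hS j)) =
            (Matrix.of fun i j => v (S.orderEmbOfFin hS j) (Fin.castLE hk i)) *
              Matrix.diagonal fun j => z (S.orderEmbOfFin hS j) := by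
          ext i j; rw [Matrix.mul_diagonal]; rfl
        have e2 : ∏ j, z (S.orderEmbOfFin hS j) = ∏ a ∈ S, z a := by
          conv_rhs => rw [← Finset.map_orderEmbOfFin_univ S hS, Finset.prod_map]
          rfl
        rw [e, Matrix.det_mul, Matrix.det_diagonal, e2, ← hminor S hS hSn]
        ring)
    rw [← det_cmv k fun j hj => (hα.1 j (by omega)).le, ← cmv_submatrix hk, Finset.mul_sum]
    rw [show (∑ S ∈ Finset.powersetCard (k + 1) (Finset.Icc 1 n),
      (c : ℂ) * ((∏ j ∈ S, z j) * (W S : ℂ))) = ∑ S ∈ Finset.powersetCard (k + 1) (Finset.Icc 1 n),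
      (∏ j ∈ S, z j) * ((c * W S : ℝ) : ℂ) from Finset.sum_congr rfl fun S _ => by
        push_cast; ring, ← this]
    congr 1
    ext i j
    rw [Matrix.submatrix_apply, h.apply_eq h.eigen]
    exact Finset.sum_congr rfl fun l _ => by ring
  set Z := ∑ S ∈ Finset.powersetCard (k + 1) (Finset.Icc 1 n), W S with hZ
  have hone' : c * Z = 1 := by exact_mod_cast hone.symm
  have hZ0 : Z ≠ 0 := fun h0 => by simp [h0] at hone'
  have hconj := congrArg conj hdet
  simp only [map_mul, map_pow, map_neg, map_one, map_sum, map_prod, Complex.conj_conj,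
    Complex.conj_ofReal] at hconj
  have hs : ((-1 : ℂ) ^ k) * (-1) ^ k = 1 := by rw [← mul_pow]; simp
  have hZc : (Z : ℂ) ≠ 0 := by exact_mod_cast hZ0
  have hcZ : (c : ℂ) * Z = 1 := by exact_mod_cast hone'
  rw [← mul_div_assoc, eq_div_iff hZc]
  linear_combination (-(α k * Z)) * hs + (-1) ^ k * Z * hconj +
    (-1) ^ k * (∑ S ∈ Finset.powersetCard (k + 1) (Finset.Icc 1 n),
      (∏ j ∈ S, conj (z j)) * (W S : ℂ)) * hcZ

/-! ### Differentiating polynomials of matrix curves -/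

/-- The matrix-valued curve `M` has derivative `M'` at `t`, entry by entry. -/
def EntryDeriv {n : ℕ} (M : ℝ → Matrix (Fin n) (Fin n) ℂ) (M' : Matrix (Fin n) (Fin n) ℂ)
    (t : ℝ) : Prop :=
  ∀ i j, HasDerivAt (fun s => M s i j) (M' i j) t

namespace EntryDeriv

variable {n : ℕ} {M N : ℝ → Matrix (Fin n) (Fin n) ℂ} {M' N' : Matrix (Fin n) (Fin n) ℂ} {t : ℝ}

lemma const (K : Matrix (Fin n) (Fin n) ℂ) (t : ℝ) : EntryDeriv (fun _ => K) 0 t := fun i j =>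
  hasDerivAt_const t (K i j)

lemma add (hM : EntryDeriv M M' t) (hN : EntryDeriv N N' t) :
    EntryDeriv (fun s => M s + N s) (M' + N') t := fun i j => (hM i j).add (hN i j)

lemma mul (hM : EntryDeriv M M' t) (hN : EntryDeriv N N' t) :
    EntryDeriv (fun s => M s * N s) (M' * N t + M t * N') t := fun i j => by
  simp only [Matrix.mul_apply, Matrix.add_apply, ← Finset.sum_add_distrib]
  exact HasDerivAt.fun_sum fun l _ => (hM i l).mul (hN l j)

lemma conjTranspose (hM : EntryDeriv M M' t) : EntryDeriv (fun s => (M s)ᴴ) M'ᴴ t := fun i j => by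
  simp only [Matrix.conjTranspose_apply]
  exact (hM j i).star

lemma trace (hM : EntryDeriv M M' t) : HasDerivAt (fun s => (M s).trace) M'.trace t := by
  simp only [Matrix.trace, Matrix.diag]
  exact HasDerivAt.fun_sum fun i _ => hM i i

/-- The commutator with A is a derivation that vanishes on scalars, so the Lax equation passes to
every polynomial of the curve. -/
lemma aeval_lax {A : Matrix (Fin n) (Fin n) ℂ} (hM : EntryDeriv M (A * M t - M t * A) t)
    (p : Polynomial ℂ) :
    EntryDeriv (fun s => Polynomial.aeval (M s) p)
      (A * Polynomial.aeval (M t) p - Polynomial.aeval (M t) p * A) t := by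
  induction p using Polynomial.induction_on with
  | C a =>
    simp only [Polynomial.aeval_C]
    rw [Algebra.commutes, sub_self]
    exact const _ t
  | add p q hp hq =>
    simp only [map_add]
    convert hp.add hq using 1
    noncomm_ring
  | monomial m a ih =>
    simp only [pow_succ, ← mul_assoc] at ih ⊢
    simp only [map_mul (Polynomial.aeval _) (_ * _) Polynomial.X, Polynomial.aeval_X] at ih ⊢
    convert ih.mul hM using 1
    noncomm_ring

/-- M' need not commute with M, so the chain rule is available only under a trace. The test matrix Y
must be allowed to vary because the inductive step replaces it by M Y. -/
lemma exists_aeval (hM : EntryDeriv M M' t) (p : Polynomial ℂ) :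
    ∃ D, EntryDeriv (fun s => Polynomial.aeval (M s) p) D t ∧
      ∀ Y, Commute (M t) Y →
        (D * Y).trace = (Polynomial.aeval (M t) p.derivative * Y * M').trace := by
  induction p using Polynomial.induction_on with
  | C a =>
    refine ⟨0, ?_, fun Y _ => by simp⟩
    simp only [Polynomial.aeval_C]
    exact const _ t
  | add p q hp hq =>
    obtain ⟨D, hD, hDY⟩ := hp
    obtain ⟨E, hE, hEY⟩ := hq
    refine ⟨D + E, ?_, fun Y hY => ?_⟩
    · simp only [map_add]
      exact hD.add hE
    · rw [add_mul, Matrix.trace_add, hDY Y hY, hEY Y hY, Polynomial.derivative_add, map_add,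
        add_mul, add_mul, Matrix.trace_add]
  | monomial m a ih =>
    obtain ⟨D, hD, hDY⟩ := ih
    set p := Polynomial.C a * Polynomial.X ^ m with hp
    rw [pow_succ, ← mul_assoc, ← hp]
    refine ⟨D * M t + Polynomial.aeval (M t) p * M', ?_, fun Y hY => ?_⟩
    · simp only [map_mul (Polynomial.aeval _) p Polynomial.X, Polynomial.aeval_X]
      exact hD.mul hM
    · have hc : Commute (Polynomial.aeval (M t) p) Y := by
        rw [hp, map_mul, Polynomial.aeval_C, map_pow, Polynomial.aeval_X]
        exact (Algebra.commute_algebraMap_left a Y).mul_left (hY.pow_left m)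
      have h1 := hDY (M t * Y) ((Commute.refl _).mul_right hY)
      rw [Polynomial.derivative_mul, Polynomial.derivative_X, mul_one, map_add,
        map_mul _ (Polynomial.derivative p) Polynomial.X, Polynomial.aeval_X, add_mul, Matrix.trace_add, Matrix.mul_assoc, h1, add_mul, add_mul,
        Matrix.trace_add, Matrix.trace_mul_comm (Polynomial.aeval (M t) p * M') Y,
        ← Matrix.mul_assoc Y, ← hc.eq]
      simp only [Matrix.mul_assoc]

end EntryDeriv

lemma hasDerivAt_im {g : ℝ → ℂ} {g' : ℂ} {t : ℝ} (h : HasDerivAt g g' t) :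
    HasDerivAt (fun s => (g s).im) g'.im t :=
  Complex.imCLM.hasFDerivAt.comp_hasDerivAt t h

lemma hasDerivAt_re {g : ℝ → ℂ} {g' : ℂ} {t : ℝ} (h : HasDerivAt g g' t) :
    HasDerivAt (fun s => (g s).re) g'.re t :=
  Complex.reCLM.hasFDerivAt.comp_hasDerivAt t h

/-! ### Gradients and the Lax form of the flow -/

variable {n : ℕ}

lemma entryDeriv_line (B V : Matrix (Fin n) (Fin n) ℂ) (t : ℝ) :
    EntryDeriv (fun s : ℝ => B + s • V) V t := fun i j => by
  have h : HasDerivAt (fun s : ℝ => B i j + s • V i j) ((1 : ℝ) • V i j) t :=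
    ((hasDerivAt_id t).smul_const (V i j)).const_add (B i j)
  rw [one_smul] at h
  exact h

lemma lineDeriv_hamiltonian (f : Polynomial ℂ) (B V : Matrix (Fin n) (Fin n) ℂ) :
    lineDeriv ℝ (hamiltonian n f) B V = (Polynomial.aeval B f.derivative * V).trace.im := by
  obtain ⟨D, hD, hDY⟩ := (entryDeriv_line B V 0).exists_aeval f
  have h1 := hDY 1 (Commute.one_right _)
  rw [mul_one, mul_one, zero_smul, add_zero] at h1
  rw [← h1]
  exact (hasDerivAt_im hD.trace).deriv

lemma lineDeriv_re_entry (i j : Fin n) (B V : Matrix (Fin n) (Fin n) ℂ) :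
    lineDeriv ℝ (fun M : Matrix (Fin n) (Fin n) ℂ => (M i j).re) B V = (V i j).re :=
  (hasDerivAt_re (entryDeriv_line B V 0 i j)).deriv

lemma lineDeriv_im_entry (i j : Fin n) (B V : Matrix (Fin n) (Fin n) ℂ) :
    lineDeriv ℝ (fun M : Matrix (Fin n) (Fin n) ℂ => (M i j).im) B V = (V i j).im :=
  (hasDerivAt_im (entryDeriv_line B V 0 i j)).deriv

lemma grad_hamiltonian (f : Polynomial ℂ) (B : Matrix (Fin n) (Fin n) ℂ) :
    grad (hamiltonian n f) B = Polynomial.aeval B f.derivative := by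
  ext k l
  simp only [grad, Matrix.of_apply, lineDeriv_hamiltonian, Matrix.trace_mul_single, op_smul_eq_mul]
  apply Complex.ext <;> simp

lemma grad_re_entry (i j : Fin n) (B : Matrix (Fin n) (Fin n) ℂ) :
    grad (fun M : Matrix (Fin n) (Fin n) ℂ => (M i j).re) B = Matrix.single j i Complex.I := by
  ext k l
  simp only [grad, Matrix.of_apply, lineDeriv_re_entry, Matrix.single_apply]
  have e : (j = k ∧ i = l) ↔ (l = i ∧ k = j) :=
    ⟨fun h => ⟨h.2.symm, h.1.symm⟩, fun h => ⟨h.2.symm, h.1.symm⟩⟩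
  simp only [e]
  split_ifs <;> simp

lemma grad_im_entry (i j : Fin n) (B : Matrix (Fin n) (Fin n) ℂ) :
    grad (fun M : Matrix (Fin n) (Fin n) ℂ => (M i j).im) B = Matrix.single j i 1 := by
  ext k l
  simp only [grad, Matrix.of_apply, lineDeriv_im_entry, Matrix.single_apply]
  have e : (j = k ∧ i = l) ↔ (l = i ∧ k = j) :=
    ⟨fun h => ⟨h.2.symm, h.1.symm⟩, fun h => ⟨h.2.symm, h.1.symm⟩⟩
  simp only [e]
  split_ifs <;> simp

/-- The anti-Hermitian part of the Lax pair of the flow generated by `Im tr f`. -/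
noncomputable def laxMatrix (f : Polynomial ℂ) (B : Matrix (Fin n) (Fin n) ℂ) :
    Matrix (Fin n) (Fin n) ℂ :=
  projA (B * Polynomial.aeval B f.derivative)

/-- Since f'(B) commutes with B, both terms involve the same R(X) = X - 2π_a(X), with X = B f'(B).
The X parts cancel by cyclicity of the trace, leaving the commutator with π_a(X). -/
lemma bracket_hamiltonian (f : Polynomial ℂ) (ψ : Matrix (Fin n) (Fin n) ℂ → ℝ)
    (B : Matrix (Fin n) (Fin n) ℂ) :
    bracket (hamiltonian n f) ψ B =
      ((laxMatrix f B * B - B * laxMatrix f B) * grad ψ B).trace.im := by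
  set G := Polynomial.aeval B f.derivative with hG
  set g := grad ψ B with hg
  have hcomm : G * B = B * G := by
    have : Polynomial.aeval B (f.derivative * Polynomial.X) =
        Polynomial.aeval B (Polynomial.X * f.derivative) := by rw [mul_comm]
    simpa using this
  have hR : R (B * G) = B * G - (2 : ℂ) • laxMatrix f B := by
    rw [R, projL, laxMatrix, two_smul]; abel
  set A := laxMatrix f B with hA
  have e1 : ((B * G - (2 : ℂ) • A) * (g * B)).trace =
      (B * (B * G) * g).trace - 2 * (B * A * g).trace := by
    rw [← Matrix.mul_assoc, Matrix.trace_mul_comm _ B, sub_mul, mul_sub, Matrix.trace_sub,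
      Matrix.smul_mul, Matrix.mul_smul, Matrix.trace_smul, smul_eq_mul]
    simp only [Matrix.mul_assoc]
  have e2 : ((B * G - (2 : ℂ) • A) * (B * g)).trace =
      (B * (B * G) * g).trace - 2 * (A * B * g).trace := by
    rw [sub_mul, Matrix.trace_sub, Matrix.smul_mul, Matrix.trace_smul, smul_eq_mul,
      ← Matrix.mul_assoc, ← Matrix.mul_assoc, Matrix.mul_assoc B G B, hcomm]
  rw [bracket, grad_hamiltonian, ← hG, hcomm, hR, pairing, pairing, e1, e2, sub_mul,
    Matrix.trace_sub]
  simp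
  ring

/-- Real and imaginary parts of entries serve as test functions; their gradients are matrix units,
so the trace pairing returns entries of the commutator. -/
theorem IsFlow.entryDeriv {f : Polynomial ℂ} {B : ℝ → Matrix (Fin n) (Fin n) ℂ}
    (h : IsFlow (hamiltonian n f) B) (t : ℝ) :
    EntryDeriv B (laxMatrix f (B t) * B t - B t * laxMatrix f (B t)) t := by
  intro i j
  have d1 : Differentiable ℝ (fun M : Fin n → Fin n → ℂ => (M i j).re) :=
    Complex.reCLM.differentiable.comp (by fun_prop)
  have d2 : Differentiable ℝ (fun M : Fin n → Fin n → ℂ => (M i j).im) :=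
    Complex.imCLM.differentiable.comp (by fun_prop)
  have h1 := h (fun M => (M i j).re) d1 t
  have h2 := h (fun M => (M i j).im) d2 t
  rw [bracket_hamiltonian, grad_re_entry, Matrix.trace_mul_single, op_smul_eq_mul] at h1
  rw [bracket_hamiltonian, grad_im_entry, Matrix.trace_mul_single, op_smul_eq_mul] at h2
  have h3 := h1.ofReal_comp.add (h2.ofReal_comp.mul_const Complex.I)
  refine (h3.congr_of_eventuallyEq (.of_forall fun s => ?_)).congr_deriv ?_
  · simp [Complex.re_add_im]
  · apply Complex.ext <;> simp

lemma laxMatrix_conjTranspose (f : Polynomial ℂ) (B : Matrix (Fin n) (Fin n) ℂ) :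
    (laxMatrix f B)ᴴ = -laxMatrix f B := by
  ext i j
  simp only [laxMatrix, projA, Matrix.conjTranspose_apply, Matrix.of_apply, Matrix.neg_apply]
  rcases lt_trichotomy i j with h | h | h
  · simp [h, h.not_gt, h.ne']
  · simp [h]
  · simp [h, h.not_gt, h.ne']

/-! ### Isospectrality and evolution of the spectral measure -/

/-- The first row lies on or above the diagonal, so the projection only removes the real part of its
corner entry. -/
lemma projA_mul_apply_zero (hn : 1 ≤ n) (X Y : Matrix (Fin n) (Fin n) ℂ) :
    (projA X * Y) ⟨0, hn⟩ ⟨0, hn⟩ =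
      (X * Y) ⟨0, hn⟩ ⟨0, hn⟩ - (X ⟨0, hn⟩ ⟨0, hn⟩).re * Y ⟨0, hn⟩ ⟨0, hn⟩ := by
  set o : Fin n := ⟨0, hn⟩ with ho
  have h : ∀ l, projA X o l = X o l - if l = o then ((X o o).re : ℂ) else 0 := by
    intro l
    by_cases hl : l = o
    · subst hl
      apply Complex.ext <;> simp [projA]
    · have : o < l := Fin.lt_def.2 (Nat.pos_of_ne_zero fun h0 => hl (Fin.ext h0))
      simp [projA, this, hl]
  simp [Matrix.mul_apply, h, sub_mul]

lemma mul_projA_apply_zero (hn : 1 ≤ n) (X Y : Matrix (Fin n) (Fin n) ℂ) :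
    (Y * projA X) ⟨0, hn⟩ ⟨0, hn⟩ =
      -(Y * Xᴴ) ⟨0, hn⟩ ⟨0, hn⟩ + (X ⟨0, hn⟩ ⟨0, hn⟩).re * Y ⟨0, hn⟩ ⟨0, hn⟩ := by
  set o : Fin n := ⟨0, hn⟩ with ho
  have h : ∀ l, projA X l o = -conj (X o l) + if l = o then ((X o o).re : ℂ) else 0 := by
    intro l
    by_cases hl : l = o
    · subst hl
      apply Complex.ext <;> simp [projA]
    · have : o < l := Fin.lt_def.2 (Nat.pos_of_ne_zero fun h0 => hl (Fin.ext h0))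
      simp [projA, this.not_gt, hl]
  simp [Matrix.mul_apply, h, mul_add, Finset.sum_add_distrib, mul_comm]

/-- The Lax matrix is anti-Hermitian, so the derivative of p(B)ᴴp(B) is again a commutator and the
Hilbert–Schmidt norm of p(B) is constant. -/
lemma aeval_eq_zero_iff_of_flow {f : Polynomial ℂ} {B : ℝ → Matrix (Fin n) (Fin n) ℂ}
    (h : IsFlow (hamiltonian n f) B) (p : Polynomial ℂ) (t : ℝ) :
    Polynomial.aeval (B t) p = 0 ↔ Polynomial.aeval (B 0) p = 0 := by
  have hd : ∀ t, HasDerivAt (fun s => ((Polynomial.aeval (B s) p)ᴴ *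
      Polynomial.aeval (B s) p).trace) 0 t := by
    intro t
    have h1 := (h.entryDeriv t).aeval_lax p
    have h2 := (h1.conjTranspose.mul h1).trace
    convert h2 using 1
    set A := laxMatrix f (B t)
    set Y := Polynomial.aeval (B t) p
    have e : (A * Y - Y * A)ᴴ * Y + Yᴴ * (A * Y - Y * A) = A * (Yᴴ * Y) - (Yᴴ * Y) * A := by
      rw [Matrix.conjTranspose_sub, Matrix.conjTranspose_mul, Matrix.conjTranspose_mul,
        laxMatrix_conjTranspose]
      noncomm_ring
    rw [e, Matrix.trace_sub, Matrix.trace_mul_comm, sub_self]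
  have hc := is_const_of_deriv_eq_zero (fun t => (hd t).differentiableAt)
    (fun t => (hd t).deriv) t 0
  open scoped ComplexOrder in
  rw [← Matrix.trace_conjTranspose_mul_self_eq_zero_iff, hc,
    Matrix.trace_conjTranspose_mul_self_eq_zero_iff]

/-- The minimal polynomial of D annihilates C, so by spectral mapping every eigenvalue of C is one
of its roots. -/
lemma spectrum_subset_of_aeval {C D : Matrix (Fin n) (Fin n) ℂ} (hn : 1 ≤ n)
    (h : ∀ p : Polynomial ℂ, Polynomial.aeval D p = 0 → Polynomial.aeval C p = 0) :
    spectrum ℂ C ⊆ spectrum ℂ D := by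
  have : Nonempty (Fin n) := ⟨⟨0, hn⟩⟩
  intro w hw
  have h1 := spectrum.subset_polynomial_aeval C (minpoly ℂ D) (Set.mem_image_of_mem _ hw)
  rw [h _ (minpoly.aeval ℂ D), spectrum.zero_eq, Set.mem_singleton_iff] at h1
  rw [← Matrix.spectrum_toLin', ← Module.End.hasEigenvalue_iff_mem_spectrum]
  apply Module.End.hasEigenvalue_of_isRoot
  rw [Matrix.minpoly_toLin']
  exact h1

theorem spectrum_eq_of_flow (hn : 1 ≤ n) {f : Polynomial ℂ} {B : ℝ → Matrix (Fin n) (Fin n) ℂ}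
    (h : IsFlow (hamiltonian n f) B) (t : ℝ) : spectrum ℂ (B t) = spectrum ℂ (B 0) :=
  (spectrum_subset_of_aeval hn fun p => (aeval_eq_zero_iff_of_flow h p t).2).antisymm
    (spectrum_subset_of_aeval hn fun p => (aeval_eq_zero_iff_of_flow h p t).1)

/-- The Lagrange polynomial of C is the projection onto the line of `v j`. This makes the mass at
z_j an entry of a polynomial in C, hence differentiable in time although the eigenvectors are chosen
separately at each time. -/
lemma IsEigenbasis.aeval_basis {C : Matrix (Fin n) (Fin n) ℂ} {z : ℕ → ℂ} {v : ℕ → Fin n → ℂ}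
    (h : IsEigenbasis C z v) (hinj : Set.InjOn z (Set.Icc 1 n)) (q : Polynomial ℂ) {j : ℕ}
    (hj : j ∈ Finset.Icc 1 n) (i i' : Fin n) :
    Polynomial.aeval C (q * Lagrange.basis (Finset.Icc 1 n) z j) i i' =
      q.eval (z j) * (v j i * conj (v j i')) := by
  have hinj' : Set.InjOn z (Finset.Icc 1 n : Finset ℕ) := by rwa [Finset.coe_Icc]
  rw [h.apply_eq (fun l hl => h.aeval_mulVec _ hl), Finset.sum_eq_single_of_mem j hj]
  · rw [Polynomial.eval_mul, Lagrange.eval_basis_self hinj' hj]; ring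
  · intro l hl hlj
    rw [Polynomial.eval_mul, Lagrange.eval_basis_of_ne hlj.symm hl]; ring

lemma hasDerivAt_mass (hn : 1 ≤ n) {f : Polynomial ℂ} {B : ℝ → Matrix (Fin n) (Fin n) ℂ}
    (hB : IsFlow (hamiltonian n f) B) {z : ℕ → ℂ} {v : ℝ → ℕ → Fin n → ℂ}
    (hinj : Set.InjOn z (Set.Icc 1 n)) (h : ∀ t, IsEigenbasis (B t) z (v t)) {j : ℕ}
    (hj : j ∈ Finset.Icc 1 n) (t : ℝ) :
    HasDerivAt (fun s => ‖v s j ⟨0, hn⟩‖ ^ 2)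
      ((speed f (z j) - 2 * ((B t * Polynomial.aeval (B t) f.derivative) ⟨0, hn⟩ ⟨0, hn⟩).re) *
        ‖v t j ⟨0, hn⟩‖ ^ 2) t := by
  set o : Fin n := ⟨0, hn⟩ with ho
  set X := B t * Polynomial.aeval (B t) f.derivative with hX
  have hX' : X = Polynomial.aeval (B t) (Polynomial.X * f.derivative) := by
    rw [map_mul, Polynomial.aeval_X]
  set P := Lagrange.basis (Finset.Icc 1 n) z j with hP
  have hY : ∀ s i i', Polynomial.aeval (B s) P i i' = v s j i * conj (v s j i') := by
    intro s i i'
    have := (h s).aeval_basis hinj 1 hj i i'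
    rwa [one_mul, Polynomial.eval_one, one_mul] at this
  have hY0 : ∀ s, Polynomial.aeval (B s) P o o = ((‖v s j o‖ ^ 2 : ℝ) : ℂ) := fun s => by
    rw [hY, Complex.mul_conj, Complex.normSq_eq_norm_sq]
  have hYH : (Polynomial.aeval (B t) P)ᴴ = Polynomial.aeval (B t) P := by
    ext i i'
    simp only [Matrix.conjTranspose_apply, hY, Complex.star_def, map_mul, Complex.conj_conj]
    ring
  have hXY : (X * Polynomial.aeval (B t) P) o o =
      (z j * f.derivative.eval (z j)) * ((‖v t j o‖ ^ 2 : ℝ) : ℂ) := by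
    rw [hX', ← map_mul, (h t).aeval_basis hinj _ hj, Complex.mul_conj,
      Complex.normSq_eq_norm_sq, Polynomial.eval_mul, Polynomial.eval_X]
  have hYX : (Polynomial.aeval (B t) P * Xᴴ) o o =
      conj ((X * Polynomial.aeval (B t) P) o o) := by
    rw [← Complex.star_def, ← Matrix.conjTranspose_apply, Matrix.conjTranspose_mul X, hYH]
  have hd := ((hB.entryDeriv t).aeval_lax P) o o
  have hre := hasDerivAt_re hd
  simp only [hY0, Complex.ofReal_re] at hre
  convert hre using 1
  rw [Matrix.sub_apply, laxMatrix, projA_mul_apply_zero hn, mul_projA_apply_zero hn, ← hX, ← ho,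
    hYX, hXY, hY0, speed]
  simp only [Complex.sub_re, Complex.add_re, Complex.neg_re, Complex.conj_re, Complex.re_mul_ofReal,
    Complex.ofReal_re]
  ring

/-- The common rate c cancels in ratios, so (m_j / m_i) e^{(λ_i - λ_j)t} is constant. One fixed
index i supplies the normalising factor, and c never has to be integrated. -/
lemma exists_normalization {s : Finset ℕ} {i : ℕ} (hi : i ∈ s) {m : ℕ → ℝ → ℝ} {lam : ℕ → ℝ}
    {c : ℝ → ℝ} (hpos : ∀ j ∈ s, ∀ t, 0 < m j t)
    (hd : ∀ j ∈ s, ∀ t, HasDerivAt (m j) ((lam j - c t) * m j t) t) :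
    ∃ Z : ℝ → ℝ, (∀ t, 0 < Z t) ∧
      ∀ j ∈ s, ∀ t, m j t = m j 0 * Real.exp (lam j * t) * Z t := by
  refine ⟨fun t => m i t * (m i 0 * Real.exp (lam i * t))⁻¹, fun t => ?_, fun j hj t => ?_⟩
  · have := hpos i hi t
    have := hpos i hi 0
    positivity
  · have hq : ∀ t, HasDerivAt (fun t => m j t / m i t * Real.exp ((lam i - lam j) * t)) 0 t := by
      intro t
      have e1 := (hd j hj t).div (hd i hi t) (hpos i hi t).ne'
      have e2 : HasDerivAt (fun t => Real.exp ((lam i - lam j) * t))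
          (Real.exp ((lam i - lam j) * t) * ((lam i - lam j) * 1)) t :=
        ((hasDerivAt_id t).const_mul (lam i - lam j)).exp
      refine (e1.mul e2).congr_deriv ?_
      have := (hpos i hi t).ne'
      simp only [Pi.div_apply]
      field_simp
      ring
    have hc := is_const_of_deriv_eq_zero (fun t => (hq t).differentiableAt)
      (fun t => (hq t).deriv) t 0
    simp only [mul_zero, Real.exp_zero, mul_one] at hc
    have h1 := (hpos i hi t).ne'
    have h2 := (hpos i hi 0).ne'
    have h3 : Real.exp (lam i * t) = Real.exp ((lam i - lam j) * t) * Real.exp (lam j * t) := by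
      rw [← Real.exp_add]; congr 1; ring
    have h4 := Real.exp_pos (lam j * t)
    have h5 := Real.exp_pos ((lam i - lam j) * t)
    beta_reduce
    rw [h3]
    field_simp at hc ⊢
    linarith

/-- Heine's formula along the flow. -/
theorem verblunsky_eq_heineMean (hn : 1 ≤ n) {f : Polynomial ℂ} {α : ℝ → ℕ → ℂ}
    (hα : ∀ t, IsVerblunsky n (α t)) (hflow : IsFlow (hamiltonian n f) fun t => cmv n (α t))
    {z : ℕ → ℂ} (hz : spectrum ℂ (cmv n (α 0)) = z '' Set.Icc 1 n)
    (hinj : Set.InjOn z (Set.Icc 1 n)) :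
    (∀ j ∈ Set.Icc 1 n, ‖z j‖ = 1) ∧
    (∀ j ∈ Set.Icc 1 n, 0 < spectralMass (cmv n (α 0)) (z j)) ∧
    ∀ k, k + 1 ≤ n → ∀ t, α t k = (-1) ^ k * heineMean n z
      (fun j => spectralMass (cmv n (α 0)) (z j)) (fun j => speed f (z j)) (k + 1) t := by
  have hU : ∀ t, (cmv n (α t))ᴴ * cmv n (α t) = 1 := fun t => cmv_unitary hn (hα t)
  have hex : ∀ t, ∃ v, IsEigenbasis (cmv n (α t)) z v := fun t =>
    exists_isEigenbasis (hU t) ((spectrum_eq_of_flow hn hflow t).trans hz) hinj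
  choose v hv using hex
  set o : Fin n := ⟨0, hn⟩ with ho
  have hz1 : ∀ j ∈ Finset.Icc 1 n, ‖z j‖ = 1 := fun j hj => (hv 0).norm_eq_one (hU 0) hj
  have hpos : ∀ j ∈ Finset.Icc 1 n, ∀ t, 0 < ‖v t j o‖ ^ 2 := fun j hj t => by
    have hzj : z j ≠ 0 := norm_ne_zero_iff.1 (by rw [hz1 j hj]; exact one_ne_zero)
    have := eigenvector_zero_ne_zero hn (hα t) hzj ((hv t).eigen j hj) ((hv t).ne_zero hj)
    have := norm_pos_iff.2 this
    positivity
  have hmass : ∀ j ∈ Finset.Icc 1 n, spectralMass (cmv n (α 0)) (z j) = ‖v 0 j o‖ ^ 2 :=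
    fun j hj => (hv 0).spectralMass_eq (hU 0) hinj hn hj
  obtain ⟨Z, hZ, hm⟩ := exists_normalization (s := Finset.Icc 1 n) (i := 1)
    (Finset.mem_Icc.2 ⟨le_rfl, hn⟩) (m := fun j t => ‖v t j o‖ ^ 2)
    (lam := fun j => speed f (z j)) hpos
    (fun j hj t => hasDerivAt_mass hn hflow hinj hv hj t)
  refine ⟨fun j hj => hz1 j (Finset.mem_Icc.2 hj), fun j hj => ?_, fun k hk t => ?_⟩
  · rw [hmass j (Finset.mem_Icc.2 hj)]
    exact hpos j (Finset.mem_Icc.2 hj) 0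
  · rw [heine hn hk (hα t) (hv t), heineMean, tiltedMean]
    congr 1
    set I := Finset.powersetCard (k + 1) (Finset.Icc 1 n) with hI
    set W₀ := heineWeight z fun j => spectralMass (cmv n (α 0)) (z j) with hW₀
    -- The weight is homogeneous in the masses, of degree the size of S; all subsets therefore carry
    -- the same power of Z, which drops out of the quotient.
    have hW : ∀ S ∈ I, heineWeight z (fun j => ‖v t j o‖ ^ 2) S =
        Z t ^ (k + 1) * (W₀ S * Real.exp ((∑ j ∈ S, speed f (z j)) * t)) := by
      intro S hS
      obtain ⟨hSn, hSc⟩ := Finset.mem_powersetCard.1 hS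
      have e : ∀ a ∈ S, ‖v t a o‖ ^ 2 * ∏ b ∈ S.erase a, ‖z b - z a‖ =
          Z t * ((spectralMass (cmv n (α 0)) (z a) * ∏ b ∈ S.erase a, ‖z b - z a‖) *
            Real.exp (speed f (z a) * t)) := by
        intro a ha
        rw [hm a (hSn ha) t, hmass a (hSn ha)]; ring
      rw [heineWeight, Finset.prod_congr rfl e, Finset.prod_mul_distrib, Finset.prod_const, hSc,
        Finset.prod_mul_distrib, ← Real.exp_sum, Finset.sum_mul]
      rfl
    have hZc : ((Z t ^ (k + 1) : ℝ) : ℂ) ≠ 0 := by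
      exact_mod_cast (pow_pos (hZ t) _).ne'
    have s1 : ∑ S ∈ I, (∏ j ∈ S, conj (z j)) *
        (heineWeight z (fun j => ‖v t j o‖ ^ 2) S : ℂ) = ((Z t ^ (k + 1) : ℝ) : ℂ) *
        ∑ S ∈ I, (∏ j ∈ S, conj (z j)) *
          ((W₀ S * Real.exp ((∑ j ∈ S, speed f (z j)) * t) : ℝ) : ℂ) := by
      rw [Finset.mul_sum]
      refine Finset.sum_congr rfl fun S hS => ?_
      rw [hW S hS, Complex.ofReal_mul]; ring
    have s2 : ∑ S ∈ I, heineWeight z (fun j => ‖v t j o‖ ^ 2) S = Z t ^ (k + 1) *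
        ∑ S ∈ I, W₀ S * Real.exp ((∑ j ∈ S, speed f (z j)) * t) := by
      rw [Finset.mul_sum]
      exact Finset.sum_congr rfl hW
    rw [s1, s2, Complex.ofReal_mul, mul_div_mul_left _ _ hZc]

/-! ### Limits, reversal of the labelling and identities for the constants -/

lemma tendsto_of_isBigO_expansion {l : Filter ℝ} {x : ℝ → ℂ} {b c : ℂ} {e r : ℝ → ℝ}
    (h : (fun t => x t - b * (1 + c * (e t : ℂ))) =O[l] r) (he : Filter.Tendsto e l (𝓝 0))
    (hr : Filter.Tendsto r l (𝓝 0)) : Filter.Tendsto x l (𝓝 b) := by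
  have h1 := h.trans_tendsto hr
  have h2 : Filter.Tendsto (fun t => b * (1 + c * (e t : ℂ))) l (𝓝 (b * (1 + c * (0 : ℝ)))) := by
    have h3 : Filter.Tendsto (fun t => (e t : ℂ)) l (𝓝 ((0 : ℝ) : ℂ)) :=
      (Complex.continuous_ofReal.tendsto 0).comp he
    exact ((h3.const_mul c).const_add 1).const_mul b
  simpa using h1.add h2

lemma tendsto_exp_neg_mul_atTop {c : ℝ} (hc : 0 < c) :
    Filter.Tendsto (fun t => Real.exp (-c * t)) Filter.atTop (𝓝 0) :=
  Real.tendsto_exp_atBot.comp (Filter.tendsto_id.const_mul_atTop_of_neg (neg_neg_of_pos hc))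

lemma tendsto_exp_mul_atBot {c : ℝ} (hc : 0 < c) :
    Filter.Tendsto (fun t => Real.exp (c * t)) Filter.atBot (𝓝 0) :=
  Real.tendsto_exp_atBot.comp (Filter.tendsto_id.const_mul_atBot hc)

lemma prod_Icc_reflect {M : Type*} [CommMonoid M] {n k : ℕ} (hk : k ≤ n) (g : ℕ → M) :
    ∏ l ∈ Finset.Icc 1 k, g (n + 1 - l) = ∏ l ∈ Finset.Icc (n - k + 1) n, g l := by
  refine Finset.prod_nbij' (fun l => n + 1 - l) (fun l => n + 1 - l) ?_ ?_ ?_ ?_ ?_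
  all_goals
    intro l hl
    rw [Finset.mem_Icc] at hl
  · simp only [Finset.mem_Icc]; omega
  · simp only [Finset.mem_Icc]; omega
  · omega
  · omega

lemma xi_reflect {n k : ℕ} (hk : 1 ≤ k) (hkn : k + 1 ≤ n) (z : ℕ → ℂ) (μ : ℕ → ℝ) :
    xi (fun j => z (n + 1 - j)) (fun j => μ (n + 1 - j)) k = zeta n z μ k := by
  have e1 : n + 1 - k = n - k + 1 := by omega
  have e2 : n + 1 - (k + 1) = n - k := by omega
  have e3 : n - (k - 1) + 1 = n - k + 2 := by omega
  have := prod_Icc_reflect (show k - 1 ≤ n by omega)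
    (fun l => ‖(z (n - k) - z l) / (z (n - k + 1) - z l)‖ ^ 2)
  rw [e3] at this
  simp only [xi, zeta, e1, e2, this]

lemma heineMean_neg (n : ℕ) (z : ℕ → ℂ) (μ lam : ℕ → ℝ) (k : ℕ) (t : ℝ) :
    heineMean n z μ (fun j => -lam j) k (-t) = heineMean n z μ lam k t := by
  simp only [heineMean, tiltedMean, Finset.sum_neg_distrib, neg_mul_neg]

/-- There is only one n-subset, so the mean is its single value; this is why α_{n-1} does not move.
-/
lemma heineMean_self {n : ℕ} {z : ℕ → ℂ} {μ : ℕ → ℝ} (lam : ℕ → ℝ)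
    (hz : Set.InjOn z (Set.Icc 1 n)) (hμ : ∀ j ∈ Set.Icc 1 n, 0 < μ j) (t : ℝ) :
    heineMean n z μ lam n t = ∏ j ∈ Finset.Icc 1 n, conj (z j) := by
  have h : Finset.powersetCard n (Finset.Icc 1 n) = {Finset.Icc 1 n} := by
    have := Finset.powersetCard_self (Finset.Icc 1 n)
    rwa [Nat.card_Icc, Nat.add_sub_cancel] at this
  have hw : 0 < heineWeight z μ (Finset.Icc 1 n) :=
    heineWeight_pos (by rwa [Finset.coe_Icc]) fun j hj => hμ j (Finset.mem_Icc.1 hj)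
  have hne : ((heineWeight z μ (Finset.Icc 1 n) *
      Real.exp ((∑ j ∈ Finset.Icc 1 n, lam j) * t) : ℝ) : ℂ) ≠ 0 := by
    exact_mod_cast (mul_pos hw (Real.exp_pos _)).ne'
  rw [heineMean, tiltedMean, h, Finset.sum_singleton, Finset.sum_singleton,
    mul_div_cancel_right₀ _ hne]

/-- The mass ratios are reciprocal, and on the unit circle |z_{k+1} - z_k|² equals (z_k conj z_{k+1}
- 1)(z_{k+1} conj z_k - 1). -/
lemma xi_mul_zeta {n k : ℕ} (hkn : k + 1 ≤ n) {z : ℕ → ℂ} {μ : ℕ → ℝ}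
    (h1 : ‖z k‖ = 1) (h2 : ‖z (k + 1)‖ = 1) (hμ1 : μ k ≠ 0) (hμ2 : μ (k + 1) ≠ 0) :
    xi z μ k * zeta n z μ (n - k) =
      ((‖z (k + 1) - z k‖ ^ 2
        * (∏ l ∈ Finset.Icc 1 (k - 1), ‖(z (k + 1) - z l) / (z k - z l)‖ ^ 2)
        * ∏ m ∈ Finset.Icc (k + 2) n, ‖(z k - z m) / (z (k + 1) - z m)‖ ^ 2 : ℝ) : ℂ) := by
  have e : n - (n - k) = k := by omega
  rw [xi, zeta, e]
  have hz1 : z k * conj (z k) = 1 := by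
    rw [Complex.mul_conj, Complex.normSq_eq_norm_sq, h1]; simp
  have hz2 : z (k + 1) * conj (z (k + 1)) = 1 := by
    rw [Complex.mul_conj, Complex.normSq_eq_norm_sq, h2]; simp
  have hsq : ((‖z (k + 1) - z k‖ ^ 2 : ℝ) : ℂ) =
      (z k * conj (z (k + 1)) - 1) * (z (k + 1) * conj (z k) - 1) := by
    rw [← Complex.normSq_eq_norm_sq, ← Complex.mul_conj, map_sub]
    linear_combination (1 - z (k + 1) * conj (z (k + 1))) * hz1
  have hm : ((μ (k + 1) / μ k : ℝ) : ℂ) * ((μ k / μ (k + 1) : ℝ) : ℂ) = 1 := by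
    rw [← Complex.ofReal_mul, div_mul_div_cancel₀ hμ1, div_self hμ2, Complex.ofReal_one]
  rw [Complex.ofReal_mul, Complex.ofReal_mul, hsq]
  linear_combination ((z k * conj (z (k + 1)) - 1) * (z (k + 1) * conj (z k) - 1) *
    ((∏ l ∈ Finset.Icc 1 (k - 1), ‖(z (k + 1) - z l) / (z k - z l)‖ ^ 2 : ℝ) : ℂ) *
    ((∏ m ∈ Finset.Icc (k + 2) n, ‖(z k - z m) / (z (k + 1) - z m)‖ ^ 2 : ℝ) : ℂ)) * hm

lemma eq_neg_div_of_eq_neg_mul_conj {a b w : ℂ} (hw : ‖w‖ = 1) (ha : a ≠ 0)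
    (hb : b = -(a * conj w)) : b ≠ 0 ∧ w = -(a / b) := by
  have h : w * conj w = 1 := by
    rw [Complex.mul_conj, Complex.normSq_eq_norm_sq, hw]; simp
  have hw0 : conj w ≠ 0 := right_ne_zero_of_mul (by rw [h]; exact one_ne_zero)
  subst hb
  refine ⟨neg_ne_zero.2 (mul_ne_zero ha hw0), ?_⟩
  field_simp
  exact h

lemma neg_one_pow_pred {k : ℕ} (hk : 1 ≤ k) : (-1 : ℂ) ^ (k - 1) = (-1) ^ (k + 1) := by
  obtain ⟨m, rfl⟩ : ∃ m, k = m + 1 := ⟨k - 1, by omega⟩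
  rw [Nat.add_sub_cancel]; ring

end CMV

/-! ### Assembly of the theorem -/

theorem mainTheorem13 (n : ℕ) (hn : 1 ≤ n) (f : Polynomial ℂ)
    (α : ℝ → ℕ → ℂ) (hα : ∀ t, CMV.IsVerblunsky n (α t))
    (hflow : CMV.IsFlow (CMV.hamiltonian n f) (fun t => CMV.cmv n (α t)))
    (z : ℕ → ℂ) (hz : spectrum ℂ (CMV.cmv n (α 0)) = z '' Set.Icc 1 n)
    (hlam : StrictAntiOn (fun j => CMV.speed f (z j)) (Set.Icc 1 n))
    (μ : ℕ → ℝ) (hμ : ∀ j, μ j = CMV.spectralMass (CMV.cmv n (α 0)) (z j)) :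
    -- the eigenvalues are time independent
    (∀ t, spectrum ℂ (CMV.cmv n (α t)) = z '' Set.Icc 1 n) ∧
    -- the numbers `ξ_{k-1}`, `ζ_{k-1}` are the asymptotic constants at `+∞` and `-∞`
    (∀ k, 1 ≤ k → k ≤ n - 1 →
      (∃ γ : ℝ, 0 < CMV.speed f (z k) - CMV.speed f (z (k + 1)) ∧
        CMV.speed f (z k) - CMV.speed f (z (k + 1)) < γ ∧
        (fun t : ℝ => α t (k - 1) - (-1) ^ (k - 1) * (∏ j ∈ Finset.Icc 1 k, conj (z j)) *
          (1 + CMV.xi z μ k *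
            (Real.exp (-(CMV.speed f (z k) - CMV.speed f (z (k + 1))) * t) : ℂ)))
          =O[Filter.atTop] fun t : ℝ => Real.exp (-γ * t)) ∧
      (∃ γ : ℝ, 0 < CMV.speed f (z (n - k)) - CMV.speed f (z (n - k + 1)) ∧
        CMV.speed f (z (n - k)) - CMV.speed f (z (n - k + 1)) < γ ∧
        (fun t : ℝ => α t (k - 1) - (-1) ^ (k - 1) *
          (∏ j ∈ Finset.Icc (n - k + 1) n, conj (z j)) *
          (1 + CMV.zeta n z μ k *
            (Real.exp ((CMV.speed f (z (n - k)) - CMV.speed f (z (n - k + 1))) * t) : ℂ)))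
          =O[Filter.atBot] fun t : ℝ => Real.exp (γ * t))) ∧
    -- the product formula for the asymptotic constants
    (∀ k, 1 ≤ k → k ≤ n - 1 →
      CMV.xi z μ k * CMV.zeta n z μ (n - k) =
        ((‖z (k + 1) - z k‖ ^ 2
          * (∏ l ∈ Finset.Icc 1 (k - 1), ‖(z (k + 1) - z l) / (z k - z l)‖ ^ 2)
          * ∏ m ∈ Finset.Icc (k + 2) n, ‖(z k - z m) / (z (k + 1) - z m)‖ ^ 2 : ℝ) : ℂ)) ∧
    -- `αp m = α_{m-1}(+∞)` and `αm m = α_{m-1}(-∞)`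
    (∃ αp αm : ℕ → ℂ,
      (∀ m, m ≤ n → Filter.Tendsto (fun t => CMV.shifted (α t) m) Filter.atTop (𝓝 (αp m))) ∧
      (∀ m, m ≤ n → Filter.Tendsto (fun t => CMV.shifted (α t) m) Filter.atBot (𝓝 (αm m))) ∧
      (∀ k, 1 ≤ k → k ≤ n - 1 →
        αp k * αm (n - k) = (-1) ^ n * ∏ j ∈ Finset.Icc 1 n, conj (z j) ∧
        (∀ t, αp k * αm (n - k) = (-1) ^ n * ((CMV.cmv n (α t))ᴴ).det) ∧
        (∀ t, αp k * αm (n - k) = -α t (n - 1))) ∧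
      (∀ j, 1 ≤ j → j ≤ n →
        αp j ≠ 0 ∧ z j = -(αp (j - 1) / αp j) ∧
        αm (n - j + 1) ≠ 0 ∧ z j = -(αm (n - j) / αm (n - j + 1)))) := by
  have hinj : Set.InjOn z (Set.Icc 1 n) := fun i hi j hj hij =>
    hlam.injOn hi hj (congrArg (CMV.speed f) hij)
  obtain rfl : μ = fun j => CMV.spectralMass (CMV.cmv n (α 0)) (z j) := funext hμ
  obtain ⟨hz1, hpos, hheine⟩ := CMV.verblunsky_eq_heineMean hn hα hflow hz hinj
  have hrefl : ∀ j ∈ Set.Icc 1 n, n + 1 - j ∈ Set.Icc 1 n := fun j hj => by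
    simp only [Set.mem_Icc] at hj ⊢; omega
  have hinj' : Set.InjOn (fun j => z (n + 1 - j)) (Set.Icc 1 n) := fun i hi j hj hij => by
    have := hinj (hrefl i hi) (hrefl j hj) hij
    simp only [Set.mem_Icc] at hi hj
    omega
  have himage : (fun j => z (n + 1 - j)) '' Set.Icc 1 n = z '' Set.Icc 1 n := by
    ext w
    constructor
    · rintro ⟨j, hj, rfl⟩
      exact ⟨_, hrefl j hj, rfl⟩
    · rintro ⟨j, hj, rfl⟩
      refine ⟨n + 1 - j, hrefl j hj, ?_⟩
      have : n + 1 - (n + 1 - j) = j := by simp only [Set.mem_Icc] at hj; omega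
      simp only [this]
  obtain ⟨hz1', hpos', hheine'⟩ :=
    CMV.verblunsky_eq_heineMean hn hα hflow (hz.trans himage.symm) hinj'
  -- Reversing both the labels and the sign of the rates preserves their strict decrease, so the
  -- expansion at +∞ can be reused in the variable -t.
  have hlam' : StrictAntiOn (fun j => -CMV.speed f (z (n + 1 - j))) (Set.Icc 1 n) :=
    fun i hi j hj hij => neg_lt_neg (hlam (hrefl j hj) (hrefl i hi) (by
      simp only [Set.mem_Icc] at hi hj; omega))
  set μ := fun j => CMV.spectralMass (CMV.cmv n (α 0)) (z j) with hμdef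
  have hasym : ∀ k, 1 ≤ k → k ≤ n - 1 →
      (∃ γ : ℝ, 0 < CMV.speed f (z k) - CMV.speed f (z (k + 1)) ∧
        CMV.speed f (z k) - CMV.speed f (z (k + 1)) < γ ∧
        (fun t : ℝ => α t (k - 1) - (-1) ^ (k - 1) * (∏ j ∈ Finset.Icc 1 k, conj (z j)) *
          (1 + CMV.xi z μ k *
            (Real.exp (-(CMV.speed f (z k) - CMV.speed f (z (k + 1))) * t) : ℂ)))
          =O[Filter.atTop] fun t : ℝ => Real.exp (-γ * t)) ∧
      (∃ γ : ℝ, 0 < CMV.speed f (z (n - k)) - CMV.speed f (z (n - k + 1)) ∧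
        CMV.speed f (z (n - k)) - CMV.speed f (z (n - k + 1)) < γ ∧
        (fun t : ℝ => α t (k - 1) - (-1) ^ (k - 1) *
          (∏ j ∈ Finset.Icc (n - k + 1) n, conj (z j)) *
          (1 + CMV.zeta n z μ k *
            (Real.exp ((CMV.speed f (z (n - k)) - CMV.speed f (z (n - k + 1))) * t) : ℂ)))
          =O[Filter.atBot] fun t : ℝ => Real.exp (γ * t)) := by
    intro k hk hkn
    have hk1 : k - 1 + 1 = k := by omega
    constructor
    · obtain ⟨γ, h0, hγ, hO⟩ := CMV.heineMean_asymptotics hinj hz1 hpos hlam hk hkn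
      refine ⟨γ, h0, hγ, (hO.const_mul_left ((-1) ^ (k - 1))).congr_left fun t => ?_⟩
      rw [hheine (k - 1) (by omega) t, hk1]
      ring
    · obtain ⟨γ, h0, hγ, hO⟩ := CMV.heineMean_asymptotics hinj' hz1' hpos' hlam' hk hkn
      have e1 : n + 1 - k = n - k + 1 := by omega
      have e2 : n + 1 - (k + 1) = n - k := by omega
      have hξ := CMV.xi_reflect hk (show k + 1 ≤ n by omega) z μ
      have hg : -CMV.speed f (z (n + 1 - k)) - -CMV.speed f (z (n + 1 - (k + 1))) =
          CMV.speed f (z (n - k)) - CMV.speed f (z (n - k + 1)) := by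
        rw [e1, e2]; ring
      rw [hg] at h0 hγ
      refine ⟨γ, h0, hγ, ?_⟩
      have hO' := (hO.comp_tendsto Filter.tendsto_neg_atBot_atTop).const_mul_left
        ((-1) ^ (k - 1))
      refine (hO'.congr_left fun t => ?_).congr_right fun t => ?_
      · have hm := CMV.heineMean_neg n (fun j => z (n + 1 - j)) (fun j => μ (n + 1 - j))
          (fun j => CMV.speed f (z (n + 1 - j))) k t
        have hprod := CMV.prod_Icc_reflect (show k ≤ n by omega) (fun j => conj (z j))
        rw [hheine' (k - 1) (by omega) t, hk1, ← hprod, ← hξ, Function.comp_apply, hg, hm,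
          neg_mul_neg]
        ring
      · simp
  have hlast : ∀ t, α t (n - 1) = (-1) ^ (n + 1) * ∏ j ∈ Finset.Icc 1 n, conj (z j) := by
    intro t
    have hn1 : n - 1 + 1 = n := by omega
    rw [hheine (n - 1) (by omega) t, hn1, CMV.heineMean_self _ hinj hpos,
      CMV.neg_one_pow_pred hn]
  have hconj : ∀ j ∈ Set.Icc 1 n, conj (z j) ≠ 0 := fun j hj h => by
    have := hz1 j hj
    rw [← RCLike.norm_conj, h, norm_zero] at this
    exact zero_ne_one this
  have hprod0 : ∀ s : Finset ℕ, s ⊆ Finset.Icc 1 n → ∏ j ∈ s, conj (z j) ≠ 0 := fun s hs =>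
    Finset.prod_ne_zero_iff.2 fun j hj => hconj j (Finset.mem_Icc.1 (hs hj))
  have hsign : ∀ m : ℕ, (-1 : ℂ) ^ m ≠ 0 := fun m => pow_ne_zero _ (by norm_num)
  refine ⟨fun t => (CMV.spectrum_eq_of_flow hn hflow t).trans hz, hasym, fun k hk hkn => ?_,
    -- The index is shifted by one: m = 0 gives an empty product and the value -1 of α_{-1}.
    fun m => (-1) ^ (m + 1) * ∏ j ∈ Finset.Icc 1 m, conj (z j),
    fun m => (-1) ^ (m + 1) * ∏ j ∈ Finset.Icc (n - m + 1) n, conj (z j), ?_, ?_, ?_, ?_⟩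
  · have m1 : k ∈ Set.Icc 1 n := ⟨hk, by omega⟩
    have m2 : k + 1 ∈ Set.Icc 1 n := ⟨by omega, by omega⟩
    exact CMV.xi_mul_zeta (by omega) (hz1 k m1) (hz1 _ m2) (hpos k m1).ne' (hpos _ m2).ne'
  · rintro (_ | m) hm
    · simp [CMV.shifted]
    · simp only [CMV.shifted]
      -- The expansions stop at α_{n-2}; the last coefficient is constant and is treated separately.
      rcases Nat.lt_or_ge (m + 1) n with h | h
      · obtain ⟨γ, h0, hγ, hO⟩ := (hasym (m + 1) (by omega) (by omega)).1
        rw [CMV.neg_one_pow_pred (by omega)] at hO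
        exact CMV.tendsto_of_isBigO_expansion hO (CMV.tendsto_exp_neg_mul_atTop h0)
          (CMV.tendsto_exp_neg_mul_atTop (h0.trans hγ))
      · obtain rfl : n = m + 1 := by omega
        exact tendsto_const_nhds.congr fun t => (hlast t).symm
  · rintro (_ | m) hm
    · simp [CMV.shifted]
    · simp only [CMV.shifted]
      rcases Nat.lt_or_ge (m + 1) n with h | h
      · obtain ⟨γ, h0, hγ, hO⟩ := (hasym (m + 1) (by omega) (by omega)).2
        rw [CMV.neg_one_pow_pred (by omega)] at hO
        exact CMV.tendsto_of_isBigO_expansion hO (CMV.tendsto_exp_mul_atBot h0)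
          (CMV.tendsto_exp_mul_atBot (h0.trans hγ))
      · obtain rfl : n = m + 1 := by omega
        rw [Nat.sub_self, zero_add]
        exact tendsto_const_nhds.congr fun t => (hlast t).symm
  · intro k hk hkn
    have hsplit : (-1) ^ (k + 1) * (∏ j ∈ Finset.Icc 1 k, conj (z j)) * ((-1) ^ (n - k + 1) *
        ∏ j ∈ Finset.Icc (n - (n - k) + 1) n, conj (z j)) =
        (-1) ^ n * ∏ j ∈ Finset.Icc 1 n, conj (z j) := by
      have e1 : n - (n - k) + 1 = k + 1 := by omega
      have e2 : Finset.Icc 1 n = Finset.Icc 1 k ∪ Finset.Icc (k + 1) n := by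
        ext x; simp only [Finset.mem_union, Finset.mem_Icc]; omega
      have e3 : Disjoint (Finset.Icc 1 k) (Finset.Icc (k + 1) n) := by
        rw [Finset.disjoint_left]; intro x; simp only [Finset.mem_Icc]; omega
      have e4 : (-1 : ℂ) ^ (k + 1) * (-1) ^ (n - k + 1) = (-1) ^ n := by
        rw [← pow_add, show k + 1 + (n - k + 1) = n + 2 by omega]; ring
      rw [e1, e2, Finset.prod_union e3, ← e4]
      ring
    refine ⟨hsplit, fun t => ?_, fun t => ?_⟩
    · obtain ⟨m, rfl⟩ : ∃ m, n = m + 1 := ⟨n - 1, by omega⟩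
      have hdet := CMV.det_cmv (α := α t) m fun j hj => ((hα t).1 j (by omega)).le
      have hl := hlast t
      rw [Nat.add_sub_cancel] at hl
      have hs : (-1 : ℂ) ^ m * (-1) ^ m = 1 := by rw [← mul_pow]; simp
      rw [Matrix.det_conjTranspose, hdet]
      refine hsplit.trans ?_
      simp only [star_mul', star_pow, star_neg, star_one, Complex.star_def, Complex.conj_conj]
      rw [hl]
      ring_nf
      rw [show m * 3 = m + (m + m) by ring, pow_add _ m (m + m), pow_add _ m m, hs]
      ring
    · rw [hlast t]
      refine hsplit.trans ?_
      ring
  · intro j hj hjn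
    have hnj := hz1 j ⟨hj, hjn⟩
    -- Consecutive limits differ by the factor -conj z_j, which is inverted using |z_j| = 1.
    have hp := CMV.eq_neg_div_of_eq_neg_mul_conj (w := z j) hnj
      (mul_ne_zero (hsign (j - 1 + 1)) (hprod0 (Finset.Icc 1 (j - 1))
        (Finset.Icc_subset_Icc le_rfl (by omega)))) (b := (-1) ^ (j + 1) *
        ∏ i ∈ Finset.Icc 1 j, conj (z i)) (by
        obtain ⟨i, rfl⟩ : ∃ i, j = i + 1 := ⟨j - 1, by omega⟩
        rw [Finset.prod_Icc_succ_top (by omega), Nat.add_sub_cancel]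
        ring)
    have e1 : n - (n - j) + 1 = j + 1 := by omega
    have e2 : n - (n - j + 1) + 1 = j := by omega
    have hm := CMV.eq_neg_div_of_eq_neg_mul_conj (w := z j) hnj
      (mul_ne_zero (hsign (n - j + 1)) (hprod0 (Finset.Icc (n - (n - j) + 1) n)
        (Finset.Icc_subset_Icc (by omega) le_rfl))) (b := (-1) ^ (n - j + 1 + 1) *
        ∏ i ∈ Finset.Icc (n - (n - j + 1) + 1) n, conj (z i)) (by
        have e3 : Finset.Icc j n = insert j (Finset.Icc (j + 1) n) := by
          ext x; simp only [Finset.mem_insert, Finset.mem_Icc]; omega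
        rw [e1, e2, e3, Finset.prod_insert (by simp)]
        ring)
    exact ⟨hp.1, hp.2, hm.1, hm.2⟩
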